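/- Let $\mathcal{E}$ be a Grothendieck topos (over $\mathcal{S}et$), let $\gamma^*S=\coprod_{S}1$ be the constant object on a set $S$, and let $K$ be a group in $\mathcal{S}et$. **Definitions.** A *cover* $\mathcal{U}=\{U_i\}_{i\in I}$ of $\mathcal{E}$ is a set-indexed family of nonempty (non-initial) objects such that $\{U_i\to 1\}_{i\in I}$ is epimorphic. A *refinement* $\mathcal{U}\to\mathcal{V}=\{V_j\}_{j\in J}$ is a function $\alpha:I\to J$ together with arrows $h_i:U_i\to V_{\alpha(i)}$. $\mathcal{P}_\mathcal{U}$ is the category of locally constant objects $(X,(S_i)_{i\in I},\theta)$ split by $\mathcal{U}$: $X\in\mathcal{E}$, the $S_i$ are sets, and $\theta_i:\gamma^*S_i\times U_i\to X\times U_i$ is an isomorphism over $U_i$. A morphism is an arrow $f:X\to Y$ of $\mathcal{E}$ together with functions $\vartheta_i:S_i\to R_i$ compatible with the trivializations. Refinements $r:\mathcal{U}\to\mathcal{V}$ induce pullback $r^*:\mathcal{P}_\mathcal{V}\to\mathcal{P}_\mathcal{U}$, which keeps the underlying object $X$. Let $\sigma_{ji}:\gamma^*S_i\times U_i\times U_j\to\gamma^*S_j\times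 U_j\times U_i$ be the descent datum determined by $\theta$. An *action triple* consists of a nonempty object $C$, arrows $u:C\to U_i$, $v:C\to U_j$, and a bijection $s:S_i\to S_j$ with $\sigma_{ji}\circ(\gamma^*S_i\times (u,v))=(\gamma^*S_j\times (v,u))\circ(\gamma^*s\times C)$. The locally constant object is a *covering projection* if, for all $i,j$ with $U_i\times U_j$ nonempty, the arrows $(u,v):C\to U_i\times U_j$ that are part of action triples form an epimorphic family. (The topos $\mathcal{G}_\mathcal{U}$ is the full subcategory of $\mathcal{P}_\mathcal{U}$ of sums of covering projections.) $c\mathcal{G}(\mathcal{E})$ is the category of all covering projections: its objects are pairs of a cover $\mathcal{U}$ and a covering projection $(X,(S_i),\theta)$ split by $\mathcal{U}$; an arrow from $(X,\mathcal{U})$ to $(Y,\mathcal{V})$ is an arrow $f:X\to Y$ of $\mathcal{E}$ for which there are a cover $\mathcal{W}$ and refinements $r:\mathcal{W}\to\mathcal{U}$, $r':\mathcal{W}\to\mathcal{V}$ such that $f$ underlies a morphism $r^*X\to r'^*Y$ of $\mathcal{P}_\mathcal{W}$. Let $\upsilon^*:c\mathcal{G}(\mathcal{E})\to\mathcal{E}$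 be the forgetful functor sending $(X,\mathcal{U})$ to $X$. In each of the categories $\mathcal{C}=\mathcal{E}$, $\mathcal{P}_\mathcal{U}$, $c\mathcal{G}(\mathcal{E})$, which have finite products preserved by the forgetful functors to $\mathcal{E}$, the object $\gamma^*K$ (with its constant trivialization) is a group. A *$K$-torsor* in $\mathcal{C}$ is an object $T$ with $T\to 1$ an epimorphism of $\mathcal{C}$, and an action $\gamma^*K\times T\to T$ such that $\varepsilon:\gamma^*K\times T\to T\times T$, $\varepsilon(x,u)=(x\cdot u,u)$, is an isomorphism; morphisms of torsors are the equivariant arrows. **Theorem.** 1. The functor $\upsilon^*$ is faithful; it sends $K$-torsors in $c\mathcal{G}(\mathcal{E})$ to $K$-torsors in $\mathcal{E}$, and the induced functor from the category of $K$-torsors in $c\mathcal{G}(\mathcal{E})$ to the category of $K$-torsors in $\mathcal{E}$ is an equivalence of categories. 2. For every $K$-torsor $T$ in $\mathcal{E}$, the locally constant object $(T,K,\varepsilon)$, split by the cover $T\to 1$, is a covering projection. It is a $K$-torsor in $\mathcal{P}_T$ (the category $\mathcal{P}_{\mathcal{U}}$ for this one-member cover) with the same arrow as action, and the product $K\times K\to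 K$ is the function that lifts the action to a morphism. (If $\mathcal{E}$ is degenerate, $1\cong 0$, the one-member cover is replaced by the empty one.) 3. Let $\mathcal{U}$ be a cover and $(T,(S_i),\theta)$ a $K$-torsor in $\mathcal{P}_\mathcal{U}$ (for instance, a $K$-torsor in $\mathcal{G}_\mathcal{U}$). Then $(T,(S_i),\theta)$ is a covering projection, the underlying object $T$ with the underlying action is a $K$-torsor in $\mathcal{E}$, and there are a refinement $r$ from $\mathcal{U}$ to the cover $T\to1$ and a $K$-equivariant isomorphism $r^*(T,K,\varepsilon)\cong(T,(S_i),\theta)$ in $\mathcal{P}_\mathcal{U}$ whose underlying arrow is $\mathrm{id}_T$. Here $r^*(T,K,\varepsilon)$ carries the same action arrow, lifted by the product of $K$. -/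

import Mathlib

open CategoryTheory Limits MonoidalCategory CartesianMonoidalCategory

universe u w v'

set_option linter.unusedSectionVars false

namespace ToposTorsors

/-- A Grothendieck topos (over `Type u`): a category equivalent to the category of sheaves of sets
on a small site. -/
class IsGrothendieckTopos (E : Type w) [Category.{u} E] : Prop where
  exists_site : ∃ (C : Type u) (_ : SmallCategory C) (J : GrothendieckTopology C),
    Nonempty (E ≌ Sheaf J (Type u))

section Site

variable {C : Type u} [SmallCategory C] {J : GrothendieckTopology C}

/-- The sheafified representables. -/
noncomputable abbrev rep (J : GrothendieckTopology C) (d : C) : Sheaf J (Type u) :=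
  (presheafToSheaf J (Type u)).obj (yoneda.obj d)

/-- Morphisms out of a sheafified representable are sections. -/
noncomputable def repEquiv (d : C) (F : Sheaf J (Type u)) :
    (rep J d ⟶ F) ≃ F.obj.obj (Opposite.op d) :=
  ((sheafificationAdjunction J (Type u)).homEquiv (yoneda.obj d) F).trans yonedaEquiv

lemma repEquiv_comp {d : C} {F G : Sheaf J (Type u)} (k : rep J d ⟶ F) (g : F ⟶ G) :
    repEquiv d G (k ≫ g) = g.hom.app _ (repEquiv d F k) := by
  unfold repEquiv
  rw [Equiv.trans_apply, Equiv.trans_apply, Adjunction.homEquiv_naturality_right, yonedaEquiv_comp]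
  rfl

lemma repEquiv_map {d c : C} {F : Sheaf J (Type u)} (f : d ⟶ c) (k : rep J c ⟶ F) :
    repEquiv d F ((presheafToSheaf J (Type u)).map (yoneda.map f) ≫ k) =
      F.obj.map f.op (repEquiv c F k) := by
  unfold repEquiv
  rw [Equiv.trans_apply, Equiv.trans_apply, Adjunction.homEquiv_naturality_left]
  exact (yonedaEquiv_naturality _ f).symm

lemma sheaf_hom_ext_rep {F G : Sheaf J (Type u)} {g h : F ⟶ G}
    (H : ∀ (d : C) (k : rep J d ⟶ F), k ≫ g = k ≫ h) : g = h := by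
  ext d x
  have := congrArg (repEquiv d.unop G) (H d.unop ((repEquiv d.unop F).symm x))
  rw [repEquiv_comp, repEquiv_comp, Equiv.apply_symm_apply] at this
  exact this

/-- A jointly epimorphic sieve of sheaves is locally surjective. -/
lemma locally_mem {B : Sheaf J (Type u)} (S : Sieve B)
    (hS : ∀ ⦃Z : Sheaf J (Type u)⦄ (g h : B ⟶ Z),
      (∀ ⦃Y⦄ (f : Y ⟶ B), S f → f ≫ g = f ≫ h) → g = h)
    {c : C} (k : rep J c ⟶ B) :
    ∃ T ∈ J c, ∀ ⦃d : C⦄ (f : d ⟶ c), T f →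
      S ((presheafToSheaf J (Type u)).map (yoneda.map f) ≫ k) := by
  let G : Subfunctor B.obj :=
    { obj := fun U => {b | S ((repEquiv U.unop B).symm b)}
      map := by
        intro U V i b hb
        change S ((repEquiv V.unop B).symm (B.obj.map i b))
        have h1 : (repEquiv V.unop B).symm (B.obj.map i b) =
            (presheafToSheaf J (Type u)).map (yoneda.map i.unop) ≫ (repEquiv U.unop B).symm b := by
          rw [Equiv.symm_apply_eq, repEquiv_map, Equiv.apply_symm_apply]
          rfl
        rw [h1]
        exact S.downward_closed hb _ }
  have hB := (isSheaf_iff_isSheaf_of_type J B.obj).1 B.property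
  let Gs : Sheaf J (Type u) := ⟨(G.sheafify J).toFunctor,
    (isSheaf_iff_isSheaf_of_type J _).2 (G.sheafify_isSheaf hB)⟩
  let ι : Gs ⟶ B := ⟨(G.sheafify J).ι⟩
  have : Mono ι := (sheafToPresheaf J _).mono_of_mono_map
    (show Mono (G.sheafify J).ι from inferInstance)
  have : Epi ι := ⟨fun {Z} g h e => by
    apply hS
    intro Y f hf
    apply sheaf_hom_ext_rep
    intro d t
    have hmem : repEquiv d B (t ≫ f) ∈ (G.sheafify J).obj (Opposite.op d) := by
      apply G.le_sheafify J
      change S _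
      rw [Equiv.symm_apply_apply]
      exact S.downward_closed hf _
    have : t ≫ f = (repEquiv d Gs).symm ⟨_, hmem⟩ ≫ ι := by
      apply (repEquiv d B).injective
      rw [repEquiv_comp _ ι]
      exact (congrArg Subtype.val ((repEquiv d Gs).apply_symm_apply ⟨_, hmem⟩)).symm
    rw [← Category.assoc, ← Category.assoc, this, Category.assoc, Category.assoc, e]⟩
  have : IsIso ι := isIso_of_mono_of_epi ι
  have hsec : repEquiv c B k ∈ (G.sheafify J).obj (Opposite.op c) := by
    have h2 : k = (k ≫ inv ι) ≫ ι := by simp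
    rw [h2, repEquiv_comp]
    exact ((repEquiv c Gs (k ≫ inv ι)) : (G.sheafify J).toFunctor.obj (Opposite.op c)).2
  refine ⟨_, hsec, ?_⟩
  intro d f hf
  change S ((repEquiv d B).symm _) at hf
  rw [← repEquiv_map f k, Equiv.symm_apply_apply] at hf
  exact hf

lemma stable_sheaf {A B : Sheaf J (Type u)} (S : Sieve B)
    (hS : ∀ ⦃Z : Sheaf J (Type u)⦄ (g h : B ⟶ Z),
      (∀ ⦃Y⦄ (f : Y ⟶ B), S f → f ≫ g = f ≫ h) → g = h) (p : A ⟶ B)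
    ⦃Z : Sheaf J (Type u)⦄ (g h : A ⟶ Z)
    (H : ∀ ⦃Y⦄ (f : Y ⟶ A), S (f ≫ p) → f ≫ g = f ≫ h) : g = h := by
  apply sheaf_hom_ext_rep
  intro c k
  obtain ⟨T, hT, hT'⟩ := locally_mem S hS (k ≫ p)
  apply (repEquiv c Z).injective
  have hZ := (isSheaf_iff_isSheaf_of_type J Z.obj).1 Z.property
  refine (hZ.isSeparated T hT).ext ?_
  intro d f hf
  have := H ((presheafToSheaf J (Type u)).map (yoneda.map f) ≫ k) (by simpa using hT' f hf)
  rw [← repEquiv_map, ← repEquiv_map, ← Category.assoc, this, Category.assoc]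

end Site

section Topos

variable {E : Type w} [Category.{u} E]

/-- A family of morphisms with common target is epimorphic if parallel pairs that agree on
all its members are equal. -/
def EpimorphicFamily {ι : Sort*} {B : E} {A : ι → E} (f : ∀ i, A i ⟶ B) : Prop :=
  ∀ ⦃Z : E⦄ (g h : B ⟶ Z), (∀ i, f i ≫ g = f i ≫ h) → g = h

variable [IsGrothendieckTopos E]

lemma stable {A B : E} (S : Sieve B)
    (hS : ∀ ⦃Z : E⦄ (g h : B ⟶ Z),
      (∀ ⦃Y⦄ (f : Y ⟶ B), S f → f ≫ g = f ≫ h) → g = h) (p : A ⟶ B)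
    ⦃Z : E⦄ (g h : A ⟶ Z)
    (H : ∀ ⦃Y⦄ (f : Y ⟶ A), S (f ≫ p) → f ≫ g = f ≫ h) : g = h := by
  obtain ⟨C, _, J, ⟨e⟩⟩ := IsGrothendieckTopos.exists_site (E := E)
  let S' : Sieve (e.functor.obj B) :=
    { arrows := fun Y f => S (e.inverse.map f ≫ e.unitInv.app B)
      downward_closed := by
        intro Y Z f hf g
        simpa using S.downward_closed hf (e.inverse.map g) }
  apply e.functor.map_injective
  refine stable_sheaf S' ?_ (e.functor.map p) _ _ ?_
  · intro Z g h H
    have : e.unit.app B ≫ e.inverse.map g = e.unit.app B ≫ e.inverse.map h := by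
      apply hS
      intro Y f hf
      have := H (e.functor.map f) (by
        change S _
        have h1 : e.inverse.map (e.functor.map f) ≫ e.unitInv.app B = e.unitInv.app Y ≫ f := by
          simp
        rw [h1]
        exact S.downward_closed hf _)
      have h2 : e.unit.app Y ≫ e.inverse.map (e.functor.map f ≫ g) =
        e.unit.app Y ≫ e.inverse.map (e.functor.map f ≫ h) := by rw [this]
      simpa using h2
    rw [cancel_epi] at this
    exact e.inverse.map_injective this
  · intro Y f hf
    change S _ at hf
    have := H (e.inverse.map f ≫ e.unitInv.app A) (by simpa using hf)
    have h2 : e.inverse.map (f ≫ e.functor.map g) = e.inverse.map (f ≫ e.functor.map h) := by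
      rw [← cancel_mono (e.unitInv.app Z)]
      simpa using this
    exact e.inverse.map_injective h2

variable (E) in
/-- The topology on a topos whose covering sieves are the epimorphic ones. -/
def epiTopology : GrothendieckTopology E where
  sieves X := {S | ∀ ⦃Z : E⦄ (g h : X ⟶ Z),
      (∀ ⦃Y⦄ (f : Y ⟶ X), S f → f ≫ g = f ≫ h) → g = h}
  top_mem' X Z g h H := by simpa using H (𝟙 X) trivial
  pullback_stable' X Y S p hS Z g h H := stable S hS p g h H
  transitive' X S hS R hR Z g h H := by
    apply hS
    intro Y f hf
    apply hR hf
    intro W k hk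
    simpa using H (k ≫ f) hk

/-- A small family of generators. -/
lemma exists_generators : ∃ (ι : Type u) (G : ι → E), ∀ ⦃X Z : E⦄ (g h : X ⟶ Z),
    (∀ i (k : G i ⟶ X), k ≫ g = k ≫ h) → g = h := by
  obtain ⟨C, _, J, ⟨e⟩⟩ := IsGrothendieckTopos.exists_site (E := E)
  refine ⟨C, fun c => e.inverse.obj (rep J c), ?_⟩
  intro X Z g h H
  apply e.functor.map_injective
  apply sheaf_hom_ext_rep
  intro d k
  have := H d (e.inverse.map k ≫ e.unitInv.app X)
  have h2 : e.inverse.map (k ≫ e.functor.map g) = e.inverse.map (k ≫ e.functor.map h) := by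
    rw [← cancel_mono (e.unitInv.app Z)]
    simpa using this
  exact e.inverse.map_injective h2

instance hasColimits : HasColimitsOfSize.{u, u} E := by
  obtain ⟨C, _, J, ⟨e⟩⟩ := IsGrothendieckTopos.exists_site (E := E)
  have : HasColimitsOfSize.{u, u} (Type u) := inferInstance
  have : HasColimitsOfSize.{u, u} (Sheaf J (Type u)) := Sheaf.instHasColimitsOfSize
  exact Adjunction.has_colimits_of_equivalence e.functor

instance hasLimits : HasLimitsOfSize.{u, u} E := by
  obtain ⟨C, _, J, ⟨e⟩⟩ := IsGrothendieckTopos.exists_site (E := E)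
  have : HasLimitsOfSize.{u, u} (Type u) := inferInstance
  have : HasLimitsOfSize.{u, u} (Sheaf J (Type u)) := inferInstance
  exact Adjunction.has_limits_of_equivalence e.functor

variable [CartesianMonoidalCategory E]

variable (E) in
/-- The inverse image functor `γ^* : Set ⥤ E` of the structure morphism of the topos `E`,
sending a set `S` to the coproduct of `S` copies of the terminal object. -/
noncomputable def gammaStar : Type u ⥤ E := sigmaConst.obj (𝟙_ E)

instance : PreservesFiniteLimits (gammaStar E) := by
  obtain ⟨C, _, J, ⟨e⟩⟩ := IsGrothendieckTopos.exists_site (E := E)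
  let T := (constantSheaf J (Type u)).obj PUnit.{u + 1}
  have : PreservesFiniteLimits (constantSheaf J (Type u)) :=
    comp_preservesFiniteLimits _ _
  have hT : IsTerminal T := IsTerminal.isTerminalObj (constantSheaf J (Type u)) _
    Types.isTerminalPUnit
  let a : e.inverse.obj T ≅ 𝟙_ E :=
    (hT.isTerminalObj e.inverse).uniqueUpToIso isTerminalTensorUnit
  let b : coyoneda.obj (Opposite.op (e.inverse.obj T)) ≅
      e.functor ⋙ coyoneda.obj (Opposite.op T) :=
    NatIso.ofComponents (fun X => (e.symm.toAdjunction.homEquiv T X).toIso)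
      (fun f => by ext x; exact e.symm.toAdjunction.homEquiv_naturality_right x f)
  let i : coyoneda.obj (Opposite.op (𝟙_ E)) ≅ e.functor ⋙ Sheaf.Γ J (Type u) :=
    coyoneda.mapIso a.op ≪≫ b ≪≫
      Functor.isoWhiskerLeft e.functor (Sheaf.ΓNatIsoCoyoneda J PUnit.{u + 1}).symm
  have adj := (sigmaConstAdj (𝟙_ E)).ofNatIsoRight i
  have adj' := (constantSheafΓAdj J (Type u)).comp e.symm.toAdjunction
  have : PreservesFiniteLimits e.symm.functor := inferInstance
  have : PreservesFiniteLimits (constantSheaf J (Type u) ⋙ e.symm.functor) :=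
    comp_preservesFiniteLimits _ _
  exact preservesFiniteLimits_of_natIso (adj'.leftAdjointUniq adj)

end Topos

section Gamma

variable {E : Type w} [Category.{u} E] [IsGrothendieckTopos E] [CartesianMonoidalCategory E]

noncomputable instance : (gammaStar E).Monoidal := .ofChosenFiniteProducts _

/-- The action of `γ^*` on functions. -/
noncomputable def gmap {S T : Type u} (s : S → T) : (gammaStar E).obj S ⟶ (gammaStar E).obj T :=
  (gammaStar E).map (↾s)

@[simp] lemma gmap_id (S : Type u) : gmap (E := E) (id : S → S) = 𝟙 _ :=
  (gammaStar E).map_id S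

@[simp] lemma gmap_id' (S : Type u) : gmap (E := E) (fun x : S => x) = 𝟙 _ :=
  (gammaStar E).map_id S

lemma gmap_comp {S T R : Type u} (s : S → T) (t : T → R) :
    gmap (E := E) s ≫ gmap t = gmap (t ∘ s) :=
  ((gammaStar E).map_comp (↾s) (↾t)).symm

lemma gmap_comp_assoc {S T R : Type u} (s : S → T) (t : T → R) {Z : E}
    (h : (gammaStar E).obj R ⟶ Z) : gmap s ≫ gmap t ≫ h = gmap (t ∘ s) ≫ h := by
  rw [← Category.assoc, gmap_comp]

/-- The comparison `γ^*S × γ^*T ⟶ γ^*(S × T)`, which is an isomorphism. -/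
noncomputable def gmul (S T : Type u) :
    (gammaStar E).obj S ⊗ (gammaStar E).obj T ⟶ (gammaStar E).obj (S × T) :=
  Functor.LaxMonoidal.μ (gammaStar E) S T

@[simp] lemma gmul_fst (S T : Type u) :
    gmul (E := E) S T ≫ gmap Prod.fst = fst _ _ :=
  Functor.Monoidal.μ_fst (gammaStar E) S T

@[simp] lemma gmul_fst_assoc (S T : Type u) {Z : E} (h : (gammaStar E).obj S ⟶ Z) :
    gmul (E := E) S T ≫ gmap Prod.fst ≫ h = fst _ _ ≫ h := by
  rw [← Category.assoc, gmul_fst]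

@[simp] lemma gmul_snd (S T : Type u) :
    gmul (E := E) S T ≫ gmap Prod.snd = snd _ _ :=
  Functor.Monoidal.μ_snd (gammaStar E) S T

@[simp] lemma gmul_snd_assoc (S T : Type u) {Z : E} (h : (gammaStar E).obj T ⟶ Z) :
    gmul (E := E) S T ≫ gmap Prod.snd ≫ h = snd _ _ ≫ h := by
  rw [← Category.assoc, gmul_snd]

lemma gprod_ext {S T : Type u} {A : E} {g h : A ⟶ (gammaStar E).obj (S × T)}
    (h₁ : g ≫ gmap Prod.fst = h ≫ gmap Prod.fst)
    (h₂ : g ≫ gmap Prod.snd = h ≫ gmap Prod.snd) : g = h := by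
  have : IsIso (gmul (E := E) S T) :=
    inferInstanceAs (IsIso (Functor.LaxMonoidal.μ (gammaStar E) S T))
  rw [← cancel_mono (inv (gmul (E := E) S T))]
  apply CartesianMonoidalCategory.hom_ext
  · rw [Category.assoc, Category.assoc, ← gmul_fst, IsIso.inv_hom_id_assoc, h₁]
  · rw [Category.assoc, Category.assoc, ← gmul_snd, IsIso.inv_hom_id_assoc, h₂]

lemma lift_gmul_gmap {S T R : Type u} (m : S × T → R) (S' T' : Type u)
    (a : S' → S) (b : T' → T) {A : E} (x : A ⟶ (gammaStar E).obj S')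
    (y : A ⟶ (gammaStar E).obj T') :
    lift (x ≫ gmap a) (y ≫ gmap b) ≫ gmul S T ≫ gmap m =
      lift x y ≫ gmul S' T' ≫ gmap (fun p => m (a p.1, b p.2)) := by
  have : lift (x ≫ gmap a) (y ≫ gmap b) ≫ gmul S T =
      lift x y ≫ gmul S' T' ≫ gmap (Prod.map a b) := by
    apply gprod_ext
    · have : Prod.fst ∘ Prod.map a b = a ∘ Prod.fst := rfl
      simp only [Category.assoc, gmul_fst, lift_fst, gmap_comp, this]
      rw [← gmap_comp, gmul_fst_assoc, lift_fst_assoc]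
    · have : Prod.snd ∘ Prod.map a b = b ∘ Prod.snd := rfl
      simp only [Category.assoc, gmul_snd, lift_snd, gmap_comp, this]
      rw [← gmap_comp, gmul_snd_assoc, lift_snd_assoc]
  rw [reassoc_of% this, gmap_comp]
  rfl

/-- The global section of `γ^*S` given by an element of `S`. -/
noncomputable def gpt {S : Type u} (x : S) : 𝟙_ E ⟶ (gammaStar E).obj S :=
  Sigma.ι (fun _ : S => 𝟙_ E) x

@[simp] lemma gpt_gmap {S T : Type u} (s : S → T) (x : S) :
    gpt (E := E) x ≫ gmap s = gpt (s x) := by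
  exact (Sigma.ι_comp_map' (f := fun _ : S => 𝟙_ E) (g := fun _ : T => 𝟙_ E) s
    (fun _ => 𝟙 _) x).trans (Category.id_comp _)

@[simp] lemma gpt_gmap_assoc {S T : Type u} (s : S → T) (x : S) {Z : E}
    (h : (gammaStar E).obj T ⟶ Z) : gpt x ≫ gmap s ≫ h = gpt (s x) ≫ h := by
  rw [← Category.assoc, gpt_gmap]

lemma gamma_hom_ext {S : Type u} {Z : E} {g h : (gammaStar E).obj S ⟶ Z}
    (H : ∀ x : S, gpt x ≫ g = gpt x ≫ h) : g = h :=
  Sigma.hom_ext _ _ H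

/-- `γ^*` of a one-point set is terminal. -/
noncomputable def gunit : 𝟙_ E ≅ (gammaStar E).obj PUnit.{u + 1} where
  hom := gpt PUnit.unit
  inv := toUnit _
  hom_inv_id := toUnit_unique _ _
  inv_hom_id := by
    apply gamma_hom_ext
    rintro ⟨⟩
    rw [← Category.assoc, toUnit_unique (gpt PUnit.unit ≫ toUnit _) (𝟙 (𝟙_ E))]
    simp

lemma toUnit_gunit_hom_eq : toUnit ((gammaStar E).obj PUnit.{u + 1}) ≫ gunit.hom = 𝟙 _ :=
  gunit.inv_hom_id

/-- Pulling back an isomorphism `A × V ≅ B × V` over `V` along `u : C ⟶ V`. -/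
def pullIso {A B V C : E} (φ : A ⊗ V ≅ B ⊗ V) (hφ : φ.hom ≫ snd _ _ = snd _ _) (u : C ⟶ V) :
    A ⊗ C ≅ B ⊗ C where
  hom := lift (A ◁ u ≫ φ.hom ≫ fst _ _) (snd _ _)
  inv := lift (B ◁ u ≫ φ.inv ≫ fst _ _) (snd _ _)
  hom_inv_id := by
    have h₁ : lift (A ◁ u ≫ φ.hom ≫ fst _ _) (snd _ _) ≫ B ◁ u = A ◁ u ≫ φ.hom := by
      ext <;> simp [hφ]
    ext
    · simp only [comp_lift, lift_fst, reassoc_of% h₁]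
      simp
    · simp
  inv_hom_id := by
    have hφ' : φ.inv ≫ snd _ _ = snd _ _ := by rw [Iso.inv_comp_eq, hφ]
    have h₁ : lift (B ◁ u ≫ φ.inv ≫ fst _ _) (snd _ _) ≫ A ◁ u = B ◁ u ≫ φ.inv := by
      ext <;> simp [hφ']
    ext
    · simp only [comp_lift, lift_fst, reassoc_of% h₁]
      simp
    · simp

/-- An object is nonempty if it is not initial. -/
def IsNonempty (X : E) : Prop := IsEmpty (IsInitial X)

end Gamma

section Covers

variable (E : Type w) [Category.{u} E] [IsGrothendieckTopos E] [CartesianMonoidalCategory E]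

/-- A cover of the topos `E`: an epimorphic family `U i ⟶ 1` of nonempty objects indexed by
a set. -/
structure Cover where
  /-- the index set -/
  I : Type u
  /-- the members of the family -/
  U : I → E
  nonempty : ∀ i, IsNonempty (U i)
  epi : EpimorphicFamily (fun i => toUnit (U i))

variable {E}

/-- A refinement of covers: a morphism of families. -/
structure Refinement (𝒰 𝒱 : Cover E) where
  /-- the map of index sets -/
  α : 𝒰.I → 𝒱.I
  /-- the maps of the members -/
  h : ∀ i, 𝒰.U i ⟶ 𝒱.U (α i)

/-- An object of `E` together with a trivialization by the cover `𝒰`: these are the objects of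
the push-out topos `P_𝒰` of locally constant objects split by `𝒰`. -/
structure LocConst (𝒰 : Cover E) where
  /-- the underlying object -/
  X : E
  /-- the family of sets -/
  S : 𝒰.I → Type u
  /-- the trivialization -/
  θ : ∀ i, (gammaStar E).obj (S i) ⊗ 𝒰.U i ≅ X ⊗ 𝒰.U i
  comp_snd : ∀ i, (θ i).hom ≫ snd _ _ = snd _ _

namespace LocConst

variable {𝒰 𝒱 : Cover E}

attribute [simp] LocConst.comp_snd

@[simp] lemma comp_snd_assoc (X : LocConst 𝒰) (i : 𝒰.I) {Z : E} (h : 𝒰.U i ⟶ Z) :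
    (X.θ i).hom ≫ snd _ _ ≫ h = snd _ _ ≫ h := by
  rw [← Category.assoc, X.comp_snd]

@[simp] lemma inv_comp_snd (X : LocConst 𝒰) (i : 𝒰.I) :
    (X.θ i).inv ≫ snd _ _ = snd _ _ := by
  rw [Iso.inv_comp_eq, X.comp_snd]

@[simp] lemma inv_comp_snd_assoc (X : LocConst 𝒰) (i : 𝒰.I) {Z : E} (h : 𝒰.U i ⟶ Z) :
    (X.θ i).inv ≫ snd _ _ ≫ h = snd _ _ ≫ h := by
  rw [← Category.assoc, X.inv_comp_snd]

/-- Morphisms of locally constant objects: maps in `E` and of families of sets that are compatible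
with the trivializations. -/
@[ext]
structure Hom (X Y : LocConst 𝒰) where
  /-- the underlying map -/
  f : X.X ⟶ Y.X
  /-- the functions lifting it -/
  ϑ : ∀ i, X.S i → Y.S i
  comm : ∀ i, gmap (ϑ i) ▷ 𝒰.U i ≫ (Y.θ i).hom = (X.θ i).hom ≫ f ▷ 𝒰.U i

/-- The category `P_𝒰`. -/
noncomputable instance : Category (LocConst 𝒰) where
  Hom := Hom
  id X := { f := 𝟙 _, ϑ := fun _ => id, comm := by simp }
  comp F G :=
    { f := F.f ≫ G.f
      ϑ := fun i => G.ϑ i ∘ F.ϑ i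
      comm := fun i => by
        rw [← gmap_comp, comp_whiskerRight, Category.assoc, G.comm, reassoc_of% F.comm,
          comp_whiskerRight] }
  id_comp F := by apply Hom.ext <;> simp
  comp_id F := by apply Hom.ext <;> simp
  assoc F G H := by apply Hom.ext <;> simp [Function.comp_assoc]

@[ext] lemma hom_ext {X Y : LocConst 𝒰} {F G : X ⟶ Y} (h₁ : F.f = G.f) (h₂ : F.ϑ = G.ϑ) :
    F = G := Hom.ext h₁ h₂

@[simp] lemma id_f (X : LocConst 𝒰) : Hom.f (𝟙 X) = 𝟙 X.X := rfl
@[simp] lemma comp_f {X Y Z : LocConst 𝒰} (F : X ⟶ Y) (G : Y ⟶ Z) : (F ≫ G).f = F.f ≫ G.f := rfl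
@[simp] lemma id_ϑ (X : LocConst 𝒰) (i) : Hom.ϑ (𝟙 X) i = id := rfl
@[simp] lemma comp_ϑ {X Y Z : LocConst 𝒰} (F : X ⟶ Y) (G : Y ⟶ Z) (i) :
    (F ≫ G).ϑ i = G.ϑ i ∘ F.ϑ i := rfl

/-- The value at `u : C ⟶ U i` of the trivialization. -/
noncomputable def ev (X : LocConst 𝒰) {C : E} {i : 𝒰.I} (u : C ⟶ 𝒰.U i) :
    (gammaStar E).obj (X.S i) ⊗ C ⟶ X.X :=
  _ ◁ u ≫ (X.θ i).hom ≫ fst _ _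

@[simp] lemma whisker_ev (X : LocConst 𝒰) {C D : E} {i : 𝒰.I} (u : C ⟶ 𝒰.U i)
    (c : D ⟶ C) : _ ◁ c ≫ X.ev u = X.ev (c ≫ u) := by
  simp [ev]

@[simp] lemma whisker_ev_assoc (X : LocConst 𝒰) {C D : E} {i : 𝒰.I} (u : C ⟶ 𝒰.U i)
    (c : D ⟶ C) {Z : E} (h : X.X ⟶ Z) : _ ◁ c ≫ X.ev u ≫ h = X.ev (c ≫ u) ≫ h := by
  rw [← Category.assoc, whisker_ev]

/-- The pullback of the trivialization along `u`. -/
noncomputable def evIso (X : LocConst 𝒰) {C : E} {i : 𝒰.I} (u : C ⟶ 𝒰.U i) :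
    (gammaStar E).obj (X.S i) ⊗ C ≅ X.X ⊗ C :=
  pullIso (X.θ i) (X.comp_snd i) u

@[simp] lemma evIso_fst (X : LocConst 𝒰) {C : E} {i : 𝒰.I} (u : C ⟶ 𝒰.U i) :
    (X.evIso u).hom ≫ fst _ _ = X.ev u := by
  simp [evIso, pullIso, ev]

@[simp] lemma evIso_snd (X : LocConst 𝒰) {C : E} {i : 𝒰.I} (u : C ⟶ 𝒰.U i) :
    (X.evIso u).hom ≫ snd _ _ = snd _ _ := by
  simp [evIso, pullIso]

lemma ev_ext (X : LocConst 𝒰) {C A : E} {i : 𝒰.I} (u : C ⟶ 𝒰.U i)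
    {g h : A ⟶ (gammaStar E).obj (X.S i) ⊗ C} (h₁ : g ≫ X.ev u = h ≫ X.ev u)
    (h₂ : g ≫ snd _ _ = h ≫ snd _ _) : g = h := by
  rw [← cancel_mono (X.evIso u).hom]
  ext <;> simp [h₁, h₂]

lemma hom_ev {X Y : LocConst 𝒰} (F : X ⟶ Y) {C : E} {i : 𝒰.I} (u : C ⟶ 𝒰.U i) :
    X.ev u ≫ F.f = gmap (F.ϑ i) ▷ C ≫ Y.ev u := by
  have := F.comm i
  simp only [ev, Category.assoc]
  rw [← whiskerRight_fst, ← reassoc_of% this, ← whisker_exchange_assoc]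

/-- Constructor for morphisms. -/
def mkHom {X Y : LocConst 𝒰} (f : X.X ⟶ Y.X) (ϑ : ∀ i, X.S i → Y.S i)
    (h : ∀ i, X.ev (𝟙 (𝒰.U i)) ≫ f = gmap (ϑ i) ▷ _ ≫ Y.ev (𝟙 (𝒰.U i))) : X ⟶ Y where
  f := f
  ϑ := ϑ
  comm i := by
    have := h i
    simp only [ev, MonoidalCategory.whiskerLeft_id, Category.id_comp, Category.assoc] at this
    ext <;> simp [this]

@[simp] lemma mkHom_f {X Y : LocConst 𝒰} (f : X.X ⟶ Y.X) (ϑ : ∀ i, X.S i → Y.S i) (h) :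
    (mkHom f ϑ h).f = f := rfl
@[simp] lemma mkHom_ϑ {X Y : LocConst 𝒰} (f : X.X ⟶ Y.X) (ϑ : ∀ i, X.S i → Y.S i) (h) :
    (mkHom f ϑ h).ϑ = ϑ := rfl

/-- The pullback `(h, α)^*` of locally constant objects along a refinement of covers. -/
noncomputable abbrev pull (r : Refinement 𝒰 𝒱) (X : LocConst 𝒱) : LocConst 𝒰 where
  X := X.X
  S i := X.S (r.α i)
  θ i := X.evIso (r.h i)
  comp_snd i := by simp

@[simp] lemma pull_X (r : Refinement 𝒰 𝒱) (X : LocConst 𝒱) : (X.pull r).X = X.X := rfl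

@[simp] lemma pull_ev (r : Refinement 𝒰 𝒱) (X : LocConst 𝒱) {C : E} {i : 𝒰.I} (u : C ⟶ 𝒰.U i) :
    (X.pull r).ev u = X.ev (u ≫ r.h i) := by
  change _ ◁ u ≫ (X.evIso (r.h i)).hom ≫ fst X.X _ = _
  rw [evIso_fst, whisker_ev]

variable (𝒰) in
/-- The constant object `γ^*K` with its constant trivialization. -/
noncomputable abbrev const (K : Type u) : LocConst 𝒰 where
  X := (gammaStar E).obj K
  S _ := K
  θ _ := Iso.refl _
  comp_snd _ := by simp

@[simp] lemma const_ev (K : Type u) {C : E} {i : 𝒰.I} (u : C ⟶ 𝒰.U i) :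
    (const 𝒰 K).ev u = fst _ _ := by
  simp [ev, const]

variable (𝒰) in
/-- The terminal locally constant object. -/
noncomputable abbrev unit : LocConst 𝒰 where
  X := 𝟙_ E
  S _ := PUnit
  θ i := whiskerRightIso gunit.symm (𝒰.U i)
  comp_snd i := by simp

/-- The product of locally constant objects, with the product trivialization. -/
noncomputable abbrev prod (X Y : LocConst 𝒰) : LocConst 𝒰 where
  X := X.X ⊗ Y.X
  S i := X.S i × Y.S i
  θ i :=
    { hom := lift (lift (gmap Prod.fst ▷ _ ≫ (X.θ i).hom ≫ fst _ _)
        (gmap Prod.snd ▷ _ ≫ (Y.θ i).hom ≫ fst _ _)) (snd _ _)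
      inv := lift (lift (fst _ _ ▷ _ ≫ (X.θ i).inv ≫ fst _ _)
        (snd _ _ ▷ _ ≫ (Y.θ i).inv ≫ fst _ _) ≫ gmul _ _) (snd _ _)
      hom_inv_id := by
        have h₁ : lift (lift (gmap (E := E) Prod.fst ▷ _ ≫ (X.θ i).hom ≫ fst _ _)
          (gmap Prod.snd ▷ _ ≫ (Y.θ i).hom ≫ fst _ _)) (snd _ _) ≫ fst _ _ ▷ _ =
          gmap Prod.fst ▷ _ ≫ (X.θ i).hom := by ext <;> simp
        have h₂ : lift (lift (gmap (E := E) Prod.fst ▷ _ ≫ (X.θ i).hom ≫ fst _ _)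
          (gmap Prod.snd ▷ _ ≫ (Y.θ i).hom ≫ fst _ _)) (snd _ _) ≫ snd _ _ ▷ _ =
          gmap Prod.snd ▷ _ ≫ (Y.θ i).hom := by ext <;> simp
        ext
        · apply gprod_ext
          · simp only [comp_lift, comp_lift_assoc, reassoc_of% h₁, reassoc_of% h₂, Category.assoc,
              lift_fst_assoc, gmul_fst]
            simp
          · simp only [comp_lift, comp_lift_assoc, reassoc_of% h₁, reassoc_of% h₂, Category.assoc,
              lift_fst_assoc, gmul_snd]
            simp
        · simp
      inv_hom_id := by
        have h₁ : lift (lift (fst X.X Y.X ▷ _ ≫ (X.θ i).inv ≫ fst _ _)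
          (snd _ _ ▷ _ ≫ (Y.θ i).inv ≫ fst _ _) ≫ gmul _ _) (snd _ _) ≫ gmap Prod.fst ▷ _ =
          fst _ _ ▷ _ ≫ (X.θ i).inv := by ext <;> simp
        have h₂ : lift (lift (fst X.X Y.X ▷ _ ≫ (X.θ i).inv ≫ fst _ _)
          (snd _ _ ▷ _ ≫ (Y.θ i).inv ≫ fst _ _) ≫ gmul _ _) (snd _ _) ≫ gmap Prod.snd ▷ _ =
          snd _ _ ▷ _ ≫ (Y.θ i).inv := by ext <;> simp
        ext
        · simp only [comp_lift, Category.assoc, lift_fst, reassoc_of% h₁]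
          simp
        · simp only [comp_lift, Category.assoc, lift_snd, lift_fst,
            reassoc_of% h₂]
          simp
        · simp }
  comp_snd i := by simp

lemma prod_ev_fst (X Y : LocConst 𝒰) {C : E} {i : 𝒰.I} (u : C ⟶ 𝒰.U i) :
    (X.prod Y).ev u ≫ fst _ _ = gmap Prod.fst ▷ C ≫ X.ev u := by
  simp only [ev, prod, Category.assoc, lift_fst]
  rw [← whisker_exchange_assoc]

lemma prod_ev_snd (X Y : LocConst 𝒰) {C : E} {i : 𝒰.I} (u : C ⟶ 𝒰.U i) :
    (X.prod Y).ev u ≫ snd _ _ = gmap Prod.snd ▷ C ≫ Y.ev u := by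
  simp only [ev, prod, Category.assoc, lift_fst_assoc, lift_snd]
  rw [← whisker_exchange_assoc]

/-- The descent datum `σ_{ji}` on the family `γ^*(S i) × U i` that corresponds to the
trivialization. -/
noncomputable def descent (X : LocConst 𝒰) (i j : 𝒰.I) :
    (gammaStar E).obj (X.S i) ⊗ (𝒰.U i ⊗ 𝒰.U j) ⟶
      (gammaStar E).obj (X.S j) ⊗ (𝒰.U j ⊗ 𝒰.U i) :=
  (α_ _ _ _).inv ≫ (X.θ i).hom ▷ 𝒰.U j ≫ (α_ _ _ _).hom ≫
    X.X ◁ lift (snd _ _) (fst _ _) ≫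
      (α_ _ _ _).inv ≫ (X.θ j).inv ▷ 𝒰.U i ≫ (α_ _ _ _).hom

/-- An action triple `(u, v, s)`: spans `U i ⟵ C ⟶ U j` with `C` nonempty on which the descent
datum is given by the bijection `s : S i → S j`. -/
structure IsActionTriple (X : LocConst 𝒰) {i j : 𝒰.I} {C : E} (u : C ⟶ 𝒰.U i) (v : C ⟶ 𝒰.U j)
    (s : X.S i → X.S j) : Prop where
  nonempty : IsNonempty C
  bijective : Function.Bijective s
  comm : _ ◁ lift u v ≫ X.descent i j = gmap s ▷ C ≫ _ ◁ lift v u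

/-- A locally constant object is a covering projection if the spans that are part of action
triples form epimorphic families over `U i × U j`, whenever the latter is nonempty. -/
def IsCoveringProjection (X : LocConst 𝒰) : Prop :=
  ∀ i j : 𝒰.I, IsNonempty (𝒰.U i ⊗ 𝒰.U j) →
    EpimorphicFamily (fun t : {t : Σ C : E, (C ⟶ 𝒰.U i) × (C ⟶ 𝒰.U j) //
      ∃ s, X.IsActionTriple t.2.1 t.2.2 s} => lift t.1.2.1 t.1.2.2)

lemma actionTriple_comm_iff (X : LocConst 𝒰) {i j : 𝒰.I} {C : E} (u : C ⟶ 𝒰.U i) (v : C ⟶ 𝒰.U j)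
    (s : X.S i → X.S j) :
    _ ◁ lift u v ≫ X.descent i j = gmap s ▷ C ≫ _ ◁ lift v u ↔
      X.ev u = gmap s ▷ C ≫ X.ev v := by
  have key : _ ◁ lift u v ≫ X.descent i j = gmap s ▷ C ≫ _ ◁ lift v u ↔
      _ ◁ lift u v ≫ (α_ _ _ _).inv ≫ (X.θ i).hom ▷ 𝒰.U j ≫ (α_ _ _ _).hom ≫
        X.X ◁ lift (snd _ _) (fst _ _) ≫ (α_ _ _ _).inv =
      gmap s ▷ C ≫ _ ◁ lift v u ≫ (α_ _ _ _).inv ≫ (X.θ j).hom ▷ 𝒰.U i := by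
    rw [← cancel_mono ((α_ _ _ _).inv ≫ (X.θ j).hom ▷ 𝒰.U i)]
    simp [descent]
  have h₁ : _ ◁ lift u v ≫ (α_ _ _ _).inv = lift (_ ◁ u) (snd ((gammaStar E).obj (X.S i)) C ≫ v) := by
    ext <;> simp
  have h₂ : _ ◁ lift v u ≫ (α_ _ _ _).inv = lift (_ ◁ v) (snd ((gammaStar E).obj (X.S j)) C ≫ u) := by
    ext <;> simp
  rw [key, reassoc_of% h₁, reassoc_of% h₂]
  constructor
  · intro h
    have := congrArg (fun k => k ≫ fst _ _ ≫ fst _ _) h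
    simpa [ev] using this
  · intro h
    simp only [ev] at h
    ext <;> simp [h]

end LocConst
end Covers

section

variable {E : Type w} [Category.{u} E] [IsGrothendieckTopos E]

lemma not_isNonempty_of_hom {A B : E} (f : A ⟶ B) (hB : ¬ IsNonempty B) : ¬ IsNonempty A := by
  obtain ⟨hB⟩ := not_isEmpty_iff.1 hB
  rw [IsNonempty, not_isEmpty_iff]
  refine ⟨IsInitial.ofUniqueHom (fun Z => f ≫ hB.to Z) ?_⟩
  intro Z m
  exact stable (⊥ : Sieve B) (fun Z g h _ => hB.hom_ext g h) f _ _ (fun Y k hk => hk.elim)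

lemma IsNonempty.of_hom {A B : E} (hA : IsNonempty A) (f : A ⟶ B) : IsNonempty B := by
  by_contra hB
  exact not_isNonempty_of_hom f hB hA

lemma hom_ext_of_not_isNonempty {A B : E} (hA : ¬ IsNonempty A) (f g : A ⟶ B) : f = g := by
  obtain ⟨hA⟩ := not_isEmpty_iff.1 hA
  exact hA.hom_ext f g

lemma mem_epiTopology {X : E} {S : Sieve X} : S ∈ epiTopology E X ↔
    ∀ ⦃Z : E⦄ (g h : X ⟶ Z), (∀ ⦃Y⦄ (f : Y ⟶ X), S f → f ≫ g = f ≫ h) → g = h := Iff.rfl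

variable [CartesianMonoidalCategory E]

/-- The sieve on the terminal object defined by a downward closed class of objects. -/
def unitSieve (P : E → Prop) (hP : ∀ ⦃A B : E⦄, (A ⟶ B) → P B → P A) : Sieve (𝟙_ E) where
  arrows Y _ := P Y
  downward_closed hY g := hP g hY

namespace Cover

/-- The sieve of objects that map to a member of a cover. -/
def sieve (𝒰 : Cover E) : Sieve (𝟙_ E) :=
  unitSieve (fun Y => ∃ i, Nonempty (Y ⟶ 𝒰.U i)) (fun _ _ f ⟨i, ⟨g⟩⟩ => ⟨i, ⟨f ≫ g⟩⟩)

lemma sieve_mem (𝒰 : Cover E) : 𝒰.sieve ∈ epiTopology E (𝟙_ E) :=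
  fun _ _ _ H => 𝒰.epi _ _ (fun i => H _ ⟨i, ⟨𝟙 _⟩⟩)

/-- The cover consisting of the nonempty members of an epimorphic family. -/
abbrev ofFamily {I : Type u} (U : I → E) (h : EpimorphicFamily (fun i => toUnit (U i))) :
    Cover E where
  I := {i : I // IsNonempty (U i)}
  U i := U i
  nonempty i := i.2
  epi Z f g H := h f g (fun i => by
    by_cases hi : IsNonempty (U i)
    · exact H ⟨i, hi⟩
    · exact hom_ext_of_not_isNonempty hi _ _)

lemma exists_of_sieve (P : E → Prop) (hP : ∀ ⦃A B : E⦄, (A ⟶ B) → P B → P A)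
    (h : unitSieve P hP ∈ epiTopology E (𝟙_ E)) : ∃ 𝒰 : Cover E, ∀ i, P (𝒰.U i) := by
  obtain ⟨ι, G, hG⟩ := exists_generators (E := E)
  refine ⟨ofFamily (fun i : {i : ι // P (G i)} => G i) ?_, fun i => i.1.2⟩
  intro Z g g' H
  refine h g g' (fun Y f hY => hG _ _ (fun i k => ?_))
  have := H ⟨i, hP k hY⟩
  rwa [toUnit_unique f (toUnit Y), comp_toUnit_assoc, comp_toUnit_assoc]

variable (E) in
/-- The trivial cover (which is empty if the topos is degenerate). -/
abbrev trivial : Cover E :=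
  ofFamily (fun _ : PUnit.{u + 1} => 𝟙_ E) (fun _ _ _ H => by simpa using H PUnit.unit)

/-- The common refinement of two covers. -/
abbrev inter (𝒰 𝒱 : Cover E) : Cover E :=
  ofFamily (fun p : 𝒰.I × 𝒱.I => 𝒰.U p.1 ⊗ 𝒱.U p.2) (fun Z g h H => by
    refine (epiTopology E).intersection_covering 𝒰.sieve_mem 𝒱.sieve_mem g h ?_
    rintro Y f ⟨⟨i, ⟨a⟩⟩, ⟨j, ⟨b⟩⟩⟩
    have := lift a b ≫= H (i, j)
    rwa [toUnit_unique f (toUnit Y), ← comp_toUnit_assoc (lift a b),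
      ← comp_toUnit_assoc (lift a b)])

/-- The first projection. -/
abbrev interFst (𝒰 𝒱 : Cover E) : Refinement (𝒰.inter 𝒱) 𝒰 where
  α p := p.1.1
  h _ := fst _ _

/-- The second projection. -/
abbrev interSnd (𝒰 𝒱 : Cover E) : Refinement (𝒰.inter 𝒱) 𝒱 where
  α p := p.1.2
  h _ := snd _ _

end Cover

namespace LocConst

variable {𝒰 𝒱 : Cover E}

/-- The spans on which the descent datum is given by a bijection. -/
def spans (X : LocConst 𝒰) (i j : 𝒰.I) : Sieve (𝒰.U i ⊗ 𝒰.U j) where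
  arrows C k := ∃ s : X.S i → X.S j, Function.Bijective s ∧
    X.ev (k ≫ fst _ _) = gmap s ▷ C ≫ X.ev (k ≫ snd _ _)
  downward_closed := by
    rintro C D k ⟨s, hs, h⟩ d
    refine ⟨s, hs, ?_⟩
    rw [Category.assoc, Category.assoc, ← whisker_ev, h, ← whisker_ev X (k ≫ snd _ _) d,
      whisker_exchange_assoc]

lemma isCoveringProjection_iff (X : LocConst 𝒰) :
    X.IsCoveringProjection ↔ ∀ i j, X.spans i j ∈ epiTopology E _ := by
  constructor
  · intro h i j
    by_cases hij : IsNonempty (𝒰.U i ⊗ 𝒰.U j)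
    · intro Z g g' H
      refine h i j hij g g' ?_
      rintro ⟨⟨C, u, v⟩, s, hs⟩
      refine H _ ⟨s, hs.bijective, ?_⟩
      have := (X.actionTriple_comm_iff u v s).1 hs.comm
      simpa using this
    · intro Z g g' H
      exact hom_ext_of_not_isNonempty hij _ _
  · intro h i j hij Z g g' H
    refine h i j g g' ?_
    rintro C k ⟨s, hs, hk⟩
    by_cases hC : IsNonempty C
    · have := H ⟨⟨C, k ≫ fst _ _, k ≫ snd _ _⟩, s, hC, hs,
        (X.actionTriple_comm_iff _ _ s).2 hk⟩
      simpa using this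
    · exact hom_ext_of_not_isNonempty hC _ _

lemma IsCoveringProjection.pull {X : LocConst 𝒱} (hX : X.IsCoveringProjection)
    (r : Refinement 𝒰 𝒱) : (X.pull r).IsCoveringProjection := by
  rw [isCoveringProjection_iff] at hX ⊢
  intro i j
  refine (epiTopology E).superset_covering ?_
    ((epiTopology E).pullback_stable (r.h i ⊗ₘ r.h j) (hX (r.α i) (r.α j)))
  rintro C k ⟨s, hs, h⟩
  refine ⟨s, hs, ?_⟩
  simp only [pull_ev]
  simpa using h

lemma IsCoveringProjection.prod {X Y : LocConst 𝒰} (hX : X.IsCoveringProjection)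
    (hY : Y.IsCoveringProjection) : (X.prod Y).IsCoveringProjection := by
  rw [isCoveringProjection_iff] at hX hY ⊢
  intro i j
  refine (epiTopology E).superset_covering ?_
    ((epiTopology E).intersection_covering (hX i j) (hY i j))
  rintro C k ⟨⟨s, hs, h⟩, ⟨t, ht, h'⟩⟩
  refine ⟨Prod.map s t, hs.prodMap ht, ?_⟩
  refine CartesianMonoidalCategory.hom_ext _ _ ?_ ?_
  · rw [Category.assoc, prod_ev_fst, prod_ev_fst, h, ← comp_whiskerRight_assoc,
      ← comp_whiskerRight_assoc, gmap_comp, gmap_comp]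
    rfl
  · rw [Category.assoc, prod_ev_snd, prod_ev_snd, h', ← comp_whiskerRight_assoc,
      ← comp_whiskerRight_assoc, gmap_comp, gmap_comp]
    rfl

lemma isCoveringProjection_const (K : Type u) : (const 𝒰 K).IsCoveringProjection := by
  rw [isCoveringProjection_iff]
  intro i j
  refine (epiTopology E).superset_covering ?_ ((epiTopology E).top_mem _)
  rintro C k -
  refine ⟨id, Function.bijective_id, ?_⟩
  rw [const_ev, const_ev]
  exact (by simp : fst ((gammaStar E).obj K) C = gmap id ▷ C ≫ fst _ _)

lemma isCoveringProjection_unit : (unit 𝒰).IsCoveringProjection := by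
  rw [isCoveringProjection_iff]
  intro i j
  refine (epiTopology E).superset_covering ?_ ((epiTopology E).top_mem _)
  rintro C k -
  exact ⟨id, Function.bijective_id, toUnit_unique _ _⟩

end LocConst

variable (E) in
/-- The objects of the category `cG(E)` of covering projections: a covering projection trivialized
by some cover. -/
structure CovProj where
  /-- the cover -/
  cover : Cover E
  /-- the locally constant object -/
  obj : LocConst cover
  isCovering : obj.IsCoveringProjection

namespace CovProj

/-- A map of `E` is a map of covering projections if it lifts to a morphism in `P_𝒲` (equivalently
in its full subcategory `G_𝒲`) for a common refinement `𝒲` of the two covers. -/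
def IsLiftable (X Y : CovProj E) (f : X.obj.X ⟶ Y.obj.X) : Prop :=
  ∃ (𝒲 : Cover E) (r : Refinement 𝒲 X.cover) (r' : Refinement 𝒲 Y.cover)
    (F : X.obj.pull r ⟶ Y.obj.pull r'), F.f = f

/-- The objects over which a map lifts to functions. -/
def LocalLift (X Y : CovProj E) (f : X.obj.X ⟶ Y.obj.X) (C : E) : Prop :=
  IsNonempty C → ∃ (i : X.cover.I) (j : Y.cover.I) (u : C ⟶ X.cover.U i) (v : C ⟶ Y.cover.U j)
    (s : X.obj.S i → Y.obj.S j), X.obj.ev u ≫ f = gmap s ▷ C ≫ Y.obj.ev v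

lemma LocalLift.comp {X Y : CovProj E} {f : X.obj.X ⟶ Y.obj.X} ⦃A B : E⦄ (k : A ⟶ B)
    (h : LocalLift X Y f B) : LocalLift X Y f A := by
  intro hA
  obtain ⟨i, j, u, v, s, hs⟩ := h (hA.of_hom k)
  refine ⟨i, j, k ≫ u, k ≫ v, s, ?_⟩
  rw [← LocConst.whisker_ev, Category.assoc, hs, ← LocConst.whisker_ev, whisker_exchange_assoc]

lemma isLiftable_iff (X Y : CovProj E) (f : X.obj.X ⟶ Y.obj.X) :
    IsLiftable X Y f ↔ unitSieve (LocalLift X Y f) LocalLift.comp ∈ epiTopology E (𝟙_ E) := by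
  constructor
  · rintro ⟨𝒲, r, r', F, rfl⟩
    refine (epiTopology E).superset_covering ?_ 𝒲.sieve_mem
    rintro C - ⟨i, ⟨k⟩⟩ -
    have := LocConst.hom_ev F k
    rw [LocConst.pull_ev, LocConst.pull_ev] at this
    exact ⟨r.α i, r'.α i, k ≫ r.h i, k ≫ r'.h i, F.ϑ i, this⟩
  · intro h
    obtain ⟨𝒲, h𝒲⟩ := Cover.exists_of_sieve _ _ h
    choose a b u v s hs using fun i => h𝒲 i (𝒲.nonempty i)
    refine ⟨𝒲, ⟨a, u⟩, ⟨b, v⟩, LocConst.mkHom f s ?_, rfl⟩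
    intro i
    rw [LocConst.pull_ev, LocConst.pull_ev]
    simpa using hs i

lemma isLiftable_of_cover {X Y : CovProj E} {f : X.obj.X ⟶ Y.obj.X} (𝒲 : Cover E)
    (h : ∀ k, LocalLift X Y f (𝒲.U k)) : IsLiftable X Y f := by
  rw [isLiftable_iff]
  refine (epiTopology E).superset_covering ?_ 𝒲.sieve_mem
  rintro C - ⟨i, ⟨k⟩⟩
  exact LocalLift.comp k (h i)

lemma isLiftable_id (X : CovProj E) : IsLiftable X X (𝟙 _) :=
  isLiftable_of_cover X.cover (fun k _ => ⟨k, k, 𝟙 _, 𝟙 _, id, by simp⟩)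

lemma IsLiftable.comp {X Y Z : CovProj E} {f : X.obj.X ⟶ Y.obj.X} {g : Y.obj.X ⟶ Z.obj.X}
    (hf : IsLiftable X Y f) (hg : IsLiftable Y Z g) : IsLiftable X Z (f ≫ g) := by
  rw [isLiftable_iff] at hf hg ⊢
  refine (epiTopology E).transitive ((epiTopology E).intersection_covering hf hg) _ ?_
  rintro C c ⟨h₁, h₂⟩
  by_cases hC : IsNonempty C
  swap
  · intro W a b _
    exact hom_ext_of_not_isNonempty hC _ _
  obtain ⟨i, j, u, v, s, hs⟩ := h₁ hC
  obtain ⟨j', l, v', x, t, ht⟩ := h₂ hC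
  have hY := (LocConst.isCoveringProjection_iff _).1 Y.isCovering j j'
  refine (epiTopology E).superset_covering ?_ ((epiTopology E).pullback_stable (lift v v') hY)
  rintro D d ⟨σ, -, hσ⟩ -
  simp only [Category.assoc, lift_fst, lift_snd] at hσ
  refine ⟨i, l, d ≫ u, d ≫ x, t ∘ σ ∘ s, ?_⟩
  have e₁ : X.obj.ev (d ≫ u) ≫ f = gmap s ▷ D ≫ Y.obj.ev (d ≫ v) := by
    rw [← LocConst.whisker_ev, Category.assoc, hs, ← LocConst.whisker_ev, whisker_exchange_assoc]
  have e₂ : Y.obj.ev (d ≫ v') ≫ g = gmap t ▷ D ≫ Z.obj.ev (d ≫ x) := by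
    rw [← LocConst.whisker_ev, Category.assoc, ht, ← LocConst.whisker_ev, whisker_exchange_assoc]
  rw [reassoc_of% e₁, hσ, Category.assoc, e₂, ← gmap_comp, ← gmap_comp]
  simp

/-- Morphisms of covering projections. -/
@[ext]
structure Hom (X Y : CovProj E) where
  /-- the underlying map of `E` -/
  f : X.obj.X ⟶ Y.obj.X
  isLiftable : IsLiftable X Y f

/-- The category `cG(E)` of covering projections. -/
instance : Category (CovProj E) where
  Hom := Hom
  id X := ⟨𝟙 _, isLiftable_id X⟩
  comp F G := ⟨F.f ≫ G.f, F.isLiftable.comp G.isLiftable⟩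
  id_comp F := by apply Hom.ext; simp
  comp_id F := by apply Hom.ext; simp
  assoc F G H := by apply Hom.ext; simp

@[ext] lemma hom_ext {X Y : CovProj E} {F G : X ⟶ Y} (h : F.f = G.f) : F = G := Hom.ext h
@[simp] lemma id_f (X : CovProj E) : Hom.f (𝟙 X) = 𝟙 X.obj.X := rfl
@[simp] lemma comp_f {X Y Z : CovProj E} (F : X ⟶ Y) (G : Y ⟶ Z) :
    (F ≫ G).f = F.f ≫ G.f := rfl

variable (E) in
/-- The forgetful functor `υ^* : cG(E) ⥤ E`. -/
@[simps]
def forget : CovProj E ⥤ E where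
  obj X := X.obj.X
  map F := F.f

instance : (forget E).Faithful where
  map_injective h := hom_ext h

variable (E) in
/-- The terminal covering projection. -/
noncomputable abbrev unit : CovProj E := ⟨Cover.trivial E, .unit _, LocConst.isCoveringProjection_unit⟩

/-- The product of covering projections. -/
noncomputable abbrev prod (X Y : CovProj E) : CovProj E where
  cover := X.cover.inter Y.cover
  obj := (X.obj.pull (Cover.interFst _ _)).prod (Y.obj.pull (Cover.interSnd _ _))
  isCovering := (X.isCovering.pull _).prod (Y.isCovering.pull _)

/-- The unique map to the terminal covering projection. -/
noncomputable def toUnit' (X : CovProj E) : X ⟶ unit E where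
  f := toUnit _
  isLiftable := isLiftable_of_cover X.cover (fun k hk =>
    ⟨k, ⟨PUnit.unit, hk.of_hom (toUnit _)⟩, 𝟙 _, toUnit _, fun _ => PUnit.unit,
      toUnit_unique _ _⟩)

/-- The first projection. -/
noncomputable def fst' (X Y : CovProj E) : X.prod Y ⟶ X where
  f := fst X.obj.X Y.obj.X
  isLiftable := isLiftable_of_cover (X.cover.inter Y.cover) (fun k _ =>
    ⟨k, k.1.1, 𝟙 _, fst _ _, Prod.fst, by
      refine (LocConst.prod_ev_fst _ _ _).trans ?_
      rw [LocConst.pull_ev, Category.id_comp]⟩)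

/-- The second projection. -/
noncomputable def snd' (X Y : CovProj E) : X.prod Y ⟶ Y where
  f := snd X.obj.X Y.obj.X
  isLiftable := isLiftable_of_cover (X.cover.inter Y.cover) (fun k _ =>
    ⟨k, k.1.2, 𝟙 _, snd _ _, Prod.snd, by
      refine (LocConst.prod_ev_snd _ _ _).trans ?_
      rw [LocConst.pull_ev, Category.id_comp]⟩)

/-- The map to a product. -/
noncomputable def lift' {X Y Z : CovProj E} (F : Z ⟶ X) (G : Z ⟶ Y) : Z ⟶ X.prod Y where
  f := lift F.f G.f
  isLiftable := by
    have hf := (isLiftable_iff _ _ _).1 F.isLiftable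
    have hg := (isLiftable_iff _ _ _).1 G.isLiftable
    rw [isLiftable_iff]
    refine (epiTopology E).transitive ((epiTopology E).intersection_covering hf hg) _ ?_
    rintro C c ⟨h₁, h₂⟩
    by_cases hC : IsNonempty C
    swap
    · intro W a b _
      exact hom_ext_of_not_isNonempty hC _ _
    obtain ⟨i, j, u, v, s, hs⟩ := h₁ hC
    obtain ⟨i', l, u', x, t, ht⟩ := h₂ hC
    have hZ := (LocConst.isCoveringProjection_iff _).1 Z.isCovering i i'
    refine (epiTopology E).superset_covering ?_ ((epiTopology E).pullback_stable (lift u u') hZ)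
    rintro D d ⟨σ, -, hσ⟩ hD
    simp only [Category.assoc, lift_fst, lift_snd] at hσ
    refine ⟨i, ⟨(j, l), hD.of_hom (lift (d ≫ v) (d ≫ x))⟩, d ≫ u, lift (d ≫ v) (d ≫ x),
      fun z => (s z, t (σ z)), ?_⟩
    have e₁ : Z.obj.ev (d ≫ u) ≫ F.f = gmap s ▷ D ≫ X.obj.ev (d ≫ v) := by
      rw [← LocConst.whisker_ev, Category.assoc, hs, ← LocConst.whisker_ev, whisker_exchange_assoc]
    have e₂ : Z.obj.ev (d ≫ u') ≫ G.f = gmap t ▷ D ≫ Y.obj.ev (d ≫ x) := by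
      rw [← LocConst.whisker_ev, Category.assoc, ht, ← LocConst.whisker_ev, whisker_exchange_assoc]
    refine CartesianMonoidalCategory.hom_ext _ _ ?_ ?_
    · rw [Category.assoc, Category.assoc, lift_fst, e₁]
      refine Eq.symm ((congrArg _ (LocConst.prod_ev_fst _ _ _)).trans ?_)
      rw [LocConst.pull_ev, ← comp_whiskerRight_assoc, gmap_comp]
      simp only [Cover.interFst, lift_fst]
      rfl
    · rw [Category.assoc, Category.assoc, lift_snd, hσ, Category.assoc, e₂]
      refine Eq.symm ((congrArg _ (LocConst.prod_ev_snd _ _ _)).trans ?_)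
      rw [LocConst.pull_ev, ← comp_whiskerRight_assoc, gmap_comp, ← comp_whiskerRight_assoc,
        gmap_comp]
      simp only [Cover.interSnd, lift_snd]
      rfl

noncomputable instance : CartesianMonoidalCategory (CovProj E) :=
  .ofChosenFiniteProducts
    ⟨asEmptyCone (unit E), IsTerminal.ofUniqueHom toUnit' (fun X m => by
      ext1; exact toUnit_unique (C := E) _ _)⟩
    (fun X Y => ⟨BinaryFan.mk (fst' X Y) (snd' X Y), BinaryFan.IsLimit.mk _ lift'
      (fun F G => by ext1; exact lift_fst (C := E) _ _)
      (fun F G => by ext1; exact lift_snd (C := E) _ _)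
      (fun F G m h₁ h₂ => by
        ext1
        refine CartesianMonoidalCategory.hom_ext (C := E) _ _ ?_ ?_
        · exact (congrArg Hom.f h₁).trans (lift_fst (C := E) _ _).symm
        · exact (congrArg Hom.f h₂).trans (lift_snd (C := E) _ _).symm)⟩)

end CovProj
end

section Torsors

variable {C : Type w} [Category.{v'} C] [CartesianMonoidalCategory C]

/-- A (left) `G`-module `T` is a `G`-torsor if `T ⟶ 1` is an epimorphism and
`G × T ⟶ T × T`, `(x, t) ↦ (x · t, t)`, is an isomorphism. -/
structure IsTorsor (G : C) [MonObj G] (T : C) [ModObj G T] : Prop where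
  epi : Epi (toUnit T)
  isIso : IsIso (lift (ModObj.smul (M := G) (X := T) : G ⊗ T ⟶ T) (snd G T))

/-- The category of `G`-torsors and equivariant morphisms. -/
abbrev TorsorCat (G : C) [MonObj G] : Type _ :=
  ObjectProperty.FullSubcategory (fun T : Mod C G => IsTorsor G T.X)

end Torsors

section

variable {E : Type w} [Category.{u} E] [IsGrothendieckTopos E] [CartesianMonoidalCategory E]

lemma gmap_const {S T : Type u} (t : T) :
    gmap (E := E) (fun _ : S => t) = toUnit _ ≫ gpt t := by
  apply gamma_hom_ext
  intro x
  rw [gpt_gmap, ← Category.assoc, toUnit_unique (gpt x ≫ toUnit _) (𝟙 _), Category.id_comp]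

lemma lift_gmap_gmul {S T : Type u} :
    lift (gmap (E := E) (Prod.fst : S × T → S)) (gmap (Prod.snd : S × T → T)) ≫ gmul S T = 𝟙 _ := by
  apply gprod_ext <;> simp

lemma lift_gmul_assoc {A : E} {S T R : Type u} (x : A ⟶ (gammaStar E).obj S)
    (y : A ⟶ (gammaStar E).obj T) (z : A ⟶ (gammaStar E).obj R) :
    lift (lift x y ≫ gmul S T) z ≫ gmul (S × T) R ≫ gmap (fun p => (p.1.1, (p.1.2, p.2))) =
      lift x (lift y z ≫ gmul T R) ≫ gmul S (T × R) := by
  apply gprod_ext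
  · simp only [Category.assoc, gmap_comp, gmul_fst, lift_fst]
    rw [show (Prod.fst ∘ fun p : (S × T) × R => (p.1.1, (p.1.2, p.2))) = Prod.fst ∘ Prod.fst
      from rfl, ← gmap_comp]
    simp
  · simp only [Category.assoc, gmap_comp, gmul_snd, lift_snd]
    apply gprod_ext
    · simp only [Category.assoc, gmap_comp, gmul_fst, lift_fst]
      rw [show (Prod.fst ∘ Prod.snd ∘ fun p : (S × T) × R => (p.1.1, (p.1.2, p.2))) =
        Prod.snd ∘ Prod.fst from rfl, ← gmap_comp]
      simp
    · simp only [Category.assoc, gmap_comp, gmul_snd, lift_snd]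
      rw [show (Prod.snd ∘ Prod.snd ∘ fun p : (S × T) × R => (p.1.1, (p.1.2, p.2))) =
        Prod.snd from rfl]
      simp

/-- For a group (or monoid) `K`, the object `γ^*K` is a monoid object of `E`. -/
noncomputable instance gammaMonObj (K : Type u) [Monoid K] : MonObj ((gammaStar E).obj K) where
  one := gpt 1
  mul := gmul K K ≫ gmap (fun p => p.1 * p.2)
  one_mul := by
    have h := lift_gmul_gmap (E := E) (fun p : K × K => p.1 * p.2) PUnit.{u + 1} K (fun _ => 1) id
      (fst (𝟙_ E) ((gammaStar E).obj K) ≫ gunit.hom) (snd _ _)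
    have h₁ : gpt (E := E) (1 : K) ▷ (gammaStar E).obj K =
      lift ((fst (𝟙_ E) ((gammaStar E).obj K) ≫ gunit.hom) ≫ gmap fun _ => 1) (snd _ _) := by
      ext <;> simp [gunit]
    have h₂ : (fun p : PUnit.{u + 1} × K => 1 * id p.2) = Prod.snd := by ext; simp
    rw [h₁]
    simp only [gmap_id, Category.comp_id] at h
    rw [h, h₂, gmul_snd, lift_snd, leftUnitor_hom]
  mul_one := by
    have h := lift_gmul_gmap (E := E) (fun p : K × K => p.1 * p.2) K PUnit.{u + 1} id (fun _ => 1)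
      (fst ((gammaStar E).obj K) (𝟙_ E)) (snd _ _ ≫ gunit.hom)
    have h₁ : (gammaStar E).obj K ◁ gpt (E := E) (1 : K) =
      lift (fst ((gammaStar E).obj K) (𝟙_ E)) ((snd _ _ ≫ gunit.hom) ≫ gmap fun _ => 1) := by
      ext <;> simp [gunit]
    have h₂ : (fun p : K × PUnit.{u + 1} => id p.1 * 1) = Prod.fst := by ext; simp
    rw [h₁]
    simp only [gmap_id, Category.comp_id] at h
    rw [h, h₂, gmul_fst, lift_fst, rightUnitor_hom]
  mul_assoc := by
    let x := fst ((gammaStar E).obj K ⊗ (gammaStar E).obj K) ((gammaStar E).obj K) ≫ fst _ _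
    let y := fst ((gammaStar E).obj K ⊗ (gammaStar E).obj K) ((gammaStar E).obj K) ≫ snd _ _
    let z := snd ((gammaStar E).obj K ⊗ (gammaStar E).obj K) ((gammaStar E).obj K)
    have h₁ := lift_gmul_gmap (E := E) (fun p : K × K => p.1 * p.2) (K × K) K
      (fun p => p.1 * p.2) id (lift x y ≫ gmul _ _) z
    have h₂ := lift_gmul_gmap (E := E) (fun p : K × K => p.1 * p.2) K (K × K)
      id (fun p => p.1 * p.2) x (lift y z ≫ gmul _ _)
    have h₃ := lift_gmul_assoc x y z
    rw [← reassoc_of% h₃, gmap_comp] at h₂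
    have h₄ : (fun p : (K × K) × K => p.1.1 * p.1.2 * id p.2) =
      ((fun p : K × (K × K) => id p.1 * (p.2.1 * p.2.2)) ∘
        fun p : (K × K) × K => (p.1.1, (p.1.2, p.2))) := by
      ext p; simp [mul_assoc]
    rw [h₄, ← h₂] at h₁
    simp only [gmap_id, Category.comp_id, Category.assoc] at h₁
    have e₁ : (gmul K K ≫ gmap (E := E) fun p => p.1 * p.2) ▷ (gammaStar E).obj K =
      lift (lift x y ≫ gmul K K ≫ gmap fun p => p.1 * p.2) z := by
      ext <;> simp [x, y, z]
    have e₂ : (α_ _ _ _).hom ≫ (gammaStar E).obj K ◁ (gmul K K ≫ gmap (E := E) fun p => p.1 * p.2) =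
      lift x (lift y z ≫ gmul K K ≫ gmap fun p => p.1 * p.2) := by
      ext
      · simp [x]
      · have : (α_ ((gammaStar E).obj K) ((gammaStar E).obj K) ((gammaStar E).obj K)).hom ≫ snd _ _
          = lift y z := by ext <;> simp [y, z]
        simp [reassoc_of% this]
    rw [reassoc_of% e₂, e₁]
    exact h₁

namespace CovProj

lemma f_ext {A : E} {X Y : CovProj E} {g h : A ⟶ X.obj.X ⊗ Y.obj.X}
    (h₁ : g ≫ (fst X Y).f = h ≫ (fst X Y).f) (h₂ : g ≫ (snd X Y).f = h ≫ (snd X Y).f) : g = h :=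
  CartesianMonoidalCategory.hom_ext (C := E) (X := X.obj.X) (Y := Y.obj.X) g h h₁ h₂

lemma lift_f {X Y Z : CovProj E} (F : Z ⟶ X) (G : Z ⟶ Y) : (lift F G).f = lift F.f G.f :=
  f_ext ((congrArg Hom.f (lift_fst F G)).trans (lift_fst F.f G.f).symm)
    ((congrArg Hom.f (lift_snd F G)).trans (lift_snd F.f G.f).symm)

lemma whiskerRight_f {X Y : CovProj E} (F : X ⟶ Y) (Z : CovProj E) :
    (F ▷ Z).f = F.f ▷ Z.obj.X :=
  f_ext ((congrArg Hom.f (whiskerRight_fst F Z)).trans (whiskerRight_fst F.f Z.obj.X).symm)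
    ((congrArg Hom.f (whiskerRight_snd F Z)).trans (whiskerRight_snd F.f Z.obj.X).symm)

lemma whiskerLeft_f {X Y : CovProj E} (Z : CovProj E) (F : X ⟶ Y) :
    (Z ◁ F).f = Z.obj.X ◁ F.f :=
  f_ext ((congrArg Hom.f (whiskerLeft_fst Z F)).trans (whiskerLeft_fst Z.obj.X F.f).symm)
    ((congrArg Hom.f (whiskerLeft_snd Z F)).trans (whiskerLeft_snd Z.obj.X F.f).symm)

lemma associator_f (X Y Z : CovProj E) :
    (α_ X Y Z).hom.f = (α_ X.obj.X Y.obj.X Z.obj.X).hom := by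
  refine f_ext (X := X) (Y := Y ⊗ Z)
    ((congrArg Hom.f (associator_hom_fst X Y Z)).trans
      (associator_hom_fst X.obj.X Y.obj.X Z.obj.X).symm) (f_ext ?_ ?_)
  · exact (Category.assoc _ _ _).trans ((congrArg Hom.f (associator_hom_snd_fst X Y Z)).trans
      ((Category.assoc _ _ _).trans (associator_hom_snd_fst X.obj.X Y.obj.X Z.obj.X)).symm)
  · exact (Category.assoc _ _ _).trans ((congrArg Hom.f (associator_hom_snd_snd X Y Z)).trans
      ((Category.assoc _ _ _).trans (associator_hom_snd_snd X.obj.X Y.obj.X Z.obj.X)).symm)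

lemma leftUnitor_f (X : CovProj E) : (λ_ X).hom.f = (λ_ X.obj.X).hom :=
  (congrArg Hom.f (leftUnitor_hom X)).trans (leftUnitor_hom X.obj.X).symm

lemma rightUnitor_f (X : CovProj E) : (ρ_ X).hom.f = (ρ_ X.obj.X).hom :=
  (congrArg Hom.f (rightUnitor_hom X)).trans (rightUnitor_hom X.obj.X).symm

variable (E) in
/-- The constant covering projection `γ^*K`. -/
noncomputable abbrev const (K : Type u) : CovProj E :=
  ⟨Cover.trivial E, LocConst.const _ K, LocConst.isCoveringProjection_const K⟩

end CovProj

end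

section

variable {E : Type w} [Category.{u} E] [IsGrothendieckTopos E] [CartesianMonoidalCategory E]

namespace LocConst

lemma unit_ev_one {𝒰 𝒱 : Cover E} {K : Type u} [Monoid K] {C : E} {i : 𝒰.I} {j : 𝒱.I}
    (u : C ⟶ 𝒰.U i) (v : C ⟶ 𝒱.U j) :
    (unit 𝒰).ev u ≫ gpt (1 : K) = gmap (fun _ => 1) ▷ C ≫ (const 𝒱 K).ev v := by
  rw [const_ev, whiskerRight_fst, gmap_const, ← Category.assoc]
  congr 1
  exact toUnit_unique _ _

lemma prod_ev_mul {𝒰 : Cover E} {K : Type u} [Monoid K] {C : E} {X Y : LocConst 𝒰}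
    {i : 𝒰.I} (u : C ⟶ 𝒰.U i) (a : X.S i → K) (b : Y.S i → K)
    {x : X.X ⟶ (gammaStar E).obj K} {y : Y.X ⟶ (gammaStar E).obj K}
    (hx : X.ev u ≫ x = fst _ _ ≫ gmap a) (hy : Y.ev u ≫ y = fst _ _ ≫ gmap b) :
    (X.prod Y).ev u ≫ lift (fst _ _ ≫ x) (snd _ _ ≫ y) ≫ gmul K K ≫ gmap (fun p => p.1 * p.2) =
      fst _ _ ≫ gmap (fun p : X.S i × Y.S i => a p.1 * b p.2) := by
  have h : (X.prod Y).ev u ≫ lift (fst _ _ ≫ x) (snd _ _ ≫ y) =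
      fst _ _ ≫ lift (gmap (Prod.fst : X.S i × Y.S i → X.S i) ≫ gmap a)
        (gmap (Prod.snd : X.S i × Y.S i → Y.S i) ≫ gmap b) := by
    refine CartesianMonoidalCategory.hom_ext _ _ ?_ ?_
    · have := prod_ev_fst X Y u =≫ x
      simp only [Category.assoc] at this
      rw [Category.assoc, lift_fst, this, hx, Category.assoc, lift_fst, whiskerRight_fst_assoc]
    · have := prod_ev_snd X Y u =≫ y
      simp only [Category.assoc] at this
      rw [Category.assoc, lift_snd, this, hy, Category.assoc, lift_snd, whiskerRight_fst_assoc]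
  have h' := h =≫ (gmul K K ≫ gmap (fun p => p.1 * p.2))
  simp only [Category.assoc] at h'
  rw [h', lift_gmul_gmap (fun p : K × K => p.1 * p.2) (X.S i) (Y.S i) a b, ← Category.assoc
    (lift _ _), lift_gmap_gmul, Category.id_comp]

lemma const_prod_ev {𝒰 : Cover E} {K : Type u} [Monoid K] {C : E} {X Y : LocConst 𝒰}
    {i : 𝒰.I} (u : C ⟶ 𝒰.U i) (a : X.S i → K) (b : Y.S i → K)
    {x : X.X ⟶ (gammaStar E).obj K} {y : Y.X ⟶ (gammaStar E).obj K}
    (hx : X.ev u ≫ x = fst _ _ ≫ gmap a) (hy : Y.ev u ≫ y = fst _ _ ≫ gmap b)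
    {m : X.X ⊗ Y.X ⟶ (gammaStar E).obj K}
    (hm : m = lift (fst _ _ ≫ x) (snd _ _ ≫ y) ≫ gmul K K ≫ gmap (fun p => p.1 * p.2)) :
    (X.prod Y).ev u ≫ m = fst _ _ ≫ gmap (fun p : X.S i × Y.S i => a p.1 * b p.2) := by
  rw [hm]; exact prod_ev_mul u a b hx hy

end LocConst

namespace CovProj

/-- The unit of the group `γ^*K` in `cG(E)`. -/
noncomputable def constOne (K : Type u) [Monoid K] : 𝟙_ (CovProj E) ⟶ const E K where
  f := gpt 1
  isLiftable := isLiftable_of_cover (Cover.trivial E) (fun k _ =>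
    ⟨k, k, 𝟙 _, 𝟙 _, fun _ => 1, LocConst.unit_ev_one _ _⟩)

/-- The multiplication of the group `γ^*K` in `cG(E)`. -/
noncomputable def constMul (K : Type u) [Monoid K] : const E K ⊗ const E K ⟶ const E K where
  f := gmul K K ≫ gmap (fun p => p.1 * p.2)
  isLiftable := isLiftable_of_cover ((Cover.trivial E).inter (Cover.trivial E)) (fun k _ =>
    ⟨k, k.1.1, 𝟙 _, fst _ _, fun p : K × K => p.1 * p.2, by
      refine (LocConst.const_prod_ev (x := 𝟙 _) (y := 𝟙 _) (𝟙 _) (id : K → K) (id : K → K)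
        ?_ ?_ ?_).trans ?_
      · rw [LocConst.pull_ev, LocConst.const_ev, gmap_id]
      · rw [LocConst.pull_ev, LocConst.const_ev, gmap_id]
      · rw [Category.comp_id, Category.comp_id, lift_fst_snd, Category.id_comp]
      · rw [LocConst.const_ev, whiskerRight_fst]
        rfl⟩)

/-- The group `γ^*K` in `cG(E)`. -/
noncomputable instance constMonObj (K : Type u) [Monoid K] : MonObj (const E K) where
  one := constOne K
  mul := constMul K
  one_mul := by
    ext1
    rw [comp_f, whiskerRight_f, leftUnitor_f]
    exact MonObj.one_mul (C := E) ((gammaStar E).obj K)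
  mul_one := by
    ext1
    rw [comp_f, whiskerLeft_f, rightUnitor_f]
    exact MonObj.mul_one (C := E) ((gammaStar E).obj K)
  mul_assoc := by
    ext1
    rw [comp_f, comp_f, comp_f, whiskerLeft_f, whiskerRight_f, associator_f]
    exact MonObj.mul_assoc (C := E) ((gammaStar E).obj K)

/-- The functor from `γ^*K`-objects of `cG(E)` to `γ^*K`-objects of `E` that is induced
by the forgetful functor. -/
@[simps! obj map]
noncomputable def forgetMod (K : Type u) [Monoid K] :
    Mod (CovProj E) (const E K) ⥤ Mod E ((gammaStar E).obj K) where
  obj T := 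
    { X := (forget E).obj T.X
      mod :=
        { smul := (forget E).map (ModObj.smul (M := const E K) (X := T.X))
          one_smul := by
            have h := congrArg Hom.f (ModObj.one_smul (M := const E K) T.X)
            refine Eq.trans ?_ (h.trans (leftUnitor_f T.X))
            exact congrArg (· ≫ _) (whiskerRight_f (constOne K) T.X).symm
          mul_smul := by
            have h := congrArg Hom.f (ModObj.mul_smul (M := const E K) T.X)
            refine Eq.trans (congrArg (· ≫ _) (whiskerRight_f (constMul K) T.X).symm)
              (h.trans ?_)
            exact congr (congrArg _ (associator_f _ _ _)) (congrArg (· ≫ _) (whiskerLeft_f _ _)) } }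
  map f := Mod.Hom.mk' ((forget E).map f.hom) (by
    have h := congrArg Hom.f (IsModHom.smul_hom (A := const E K) (f := f.hom))
    exact h.trans (congrArg (· ≫ _) (whiskerLeft_f _ _)))

end CovProj
end

section

variable {E : Type w} [Category.{u} E] [IsGrothendieckTopos E] [CartesianMonoidalCategory E]

namespace LocConst

variable {𝒰 : Cover E}

lemma prod_ev_ext {X Y Z : LocConst 𝒰} {C : E} {i : 𝒰.I} {u : C ⟶ 𝒰.U i}
    {f : Z.X ⟶ (X.prod Y).X} {s : Z.S i → X.S i × Y.S i}
    (h₁ : Z.ev u ≫ f ≫ fst X.X Y.X = gmap (fun z => (s z).1) ▷ C ≫ X.ev u)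
    (h₂ : Z.ev u ≫ f ≫ snd X.X Y.X = gmap (fun z => (s z).2) ▷ C ≫ Y.ev u) :
    Z.ev u ≫ f = gmap s ▷ C ≫ (X.prod Y).ev u := by
  refine CartesianMonoidalCategory.hom_ext _ _ ?_ ?_
  · rw [Category.assoc, Category.assoc, prod_ev_fst, h₁, ← comp_whiskerRight_assoc, gmap_comp]
    rfl
  · rw [Category.assoc, Category.assoc, prod_ev_snd, h₂, ← comp_whiskerRight_assoc, gmap_comp]
    rfl

/-- The unique map to the terminal object of `P_𝒰`. -/
noncomputable def homUnit (X : LocConst 𝒰) : X ⟶ unit 𝒰 :=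
  mkHom (toUnit _) (fun _ _ => PUnit.unit) (fun _ => toUnit_unique _ _)

/-- The first projection. -/
noncomputable def homFst (X Y : LocConst 𝒰) : X.prod Y ⟶ X :=
  mkHom (fst X.X Y.X) (fun _ => Prod.fst) (fun _ => prod_ev_fst _ _ _)

/-- The second projection. -/
noncomputable def homSnd (X Y : LocConst 𝒰) : X.prod Y ⟶ Y :=
  mkHom (snd X.X Y.X) (fun _ => Prod.snd) (fun _ => prod_ev_snd _ _ _)

/-- The map to a product. -/
noncomputable def homLift {X Y Z : LocConst 𝒰} (F : Z ⟶ X) (G : Z ⟶ Y) : Z ⟶ X.prod Y :=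
  mkHom (lift F.f G.f) (fun i z => (F.ϑ i z, G.ϑ i z)) (fun i => prod_ev_ext
    (by rw [lift_fst, hom_ev]) (by rw [lift_snd, hom_ev]))

noncomputable instance : CartesianMonoidalCategory (LocConst 𝒰) :=
  .ofChosenFiniteProducts
    ⟨asEmptyCone (unit 𝒰), IsTerminal.ofUniqueHom homUnit (fun X m => by
      ext1
      · exact toUnit_unique (C := E) _ _
      · rfl)⟩
    (fun X Y => ⟨BinaryFan.mk (homFst X Y) (homSnd X Y), BinaryFan.IsLimit.mk _ homLift
      (fun F G => by ext1; exacts [lift_fst (C := E) _ _, rfl])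
      (fun F G => by ext1; exacts [lift_snd (C := E) _ _, rfl])
      (fun F G m h₁ h₂ => by
        ext1
        · refine CartesianMonoidalCategory.hom_ext (C := E) _ _ ?_ ?_
          · exact (congrArg Hom.f h₁).trans (lift_fst (C := E) _ _).symm
          · exact (congrArg Hom.f h₂).trans (lift_snd (C := E) _ _).symm
        · subst h₁ h₂
          rfl)⟩)

lemma f_ext {A : E} {X Y : LocConst 𝒰} {g h : A ⟶ X.X ⊗ Y.X}
    (h₁ : g ≫ (fst X Y).f = h ≫ (fst X Y).f) (h₂ : g ≫ (snd X Y).f = h ≫ (snd X Y).f) : g = h :=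
  CartesianMonoidalCategory.hom_ext (C := E) (X := X.X) (Y := Y.X) g h h₁ h₂

lemma whiskerRight_f {X Y : LocConst 𝒰} (F : X ⟶ Y) (Z : LocConst 𝒰) :
    (F ▷ Z).f = F.f ▷ Z.X :=
  f_ext ((congrArg Hom.f (whiskerRight_fst F Z)).trans (whiskerRight_fst F.f Z.X).symm)
    ((congrArg Hom.f (whiskerRight_snd F Z)).trans (whiskerRight_snd F.f Z.X).symm)

lemma whiskerLeft_f {X Y : LocConst 𝒰} (Z : LocConst 𝒰) (F : X ⟶ Y) :
    (Z ◁ F).f = Z.X ◁ F.f :=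
  f_ext ((congrArg Hom.f (whiskerLeft_fst Z F)).trans (whiskerLeft_fst Z.X F.f).symm)
    ((congrArg Hom.f (whiskerLeft_snd Z F)).trans (whiskerLeft_snd Z.X F.f).symm)

lemma associator_f (X Y Z : LocConst 𝒰) : (α_ X Y Z).hom.f = (α_ X.X Y.X Z.X).hom := by
  refine f_ext (X := X) (Y := Y ⊗ Z)
    ((congrArg Hom.f (associator_hom_fst X Y Z)).trans
      (associator_hom_fst X.X Y.X Z.X).symm) (f_ext ?_ ?_)
  · exact (Category.assoc _ _ _).trans ((congrArg Hom.f (associator_hom_snd_fst X Y Z)).trans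
      ((Category.assoc _ _ _).trans (associator_hom_snd_fst X.X Y.X Z.X)).symm)
  · exact (Category.assoc _ _ _).trans ((congrArg Hom.f (associator_hom_snd_snd X Y Z)).trans
      ((Category.assoc _ _ _).trans (associator_hom_snd_snd X.X Y.X Z.X)).symm)

lemma leftUnitor_f (X : LocConst 𝒰) : (λ_ X).hom.f = (λ_ X.X).hom :=
  (congrArg Hom.f (leftUnitor_hom X)).trans (leftUnitor_hom X.X).symm

lemma rightUnitor_f (X : LocConst 𝒰) : (ρ_ X).hom.f = (ρ_ X.X).hom :=
  (congrArg Hom.f (rightUnitor_hom X)).trans (rightUnitor_hom X.X).symm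

variable (𝒰) in
/-- The unit of the group `γ^*K` in `P_𝒰`. -/
noncomputable def constOne (K : Type u) [Monoid K] : 𝟙_ (LocConst 𝒰) ⟶ const 𝒰 K :=
  mkHom (X := unit 𝒰) (gpt 1) (fun _ _ => 1) (fun _ => unit_ev_one _ _)

variable (𝒰) in
/-- The multiplication of the group `γ^*K` in `P_𝒰`. -/
noncomputable def constMul (K : Type u) [Monoid K] : const 𝒰 K ⊗ const 𝒰 K ⟶ const 𝒰 K :=
  mkHom (X := (const 𝒰 K).prod (const 𝒰 K)) (gmul K K ≫ gmap (fun p => p.1 * p.2))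
    (fun _ p => p.1 * p.2) (fun i => by
      refine (const_prod_ev (x := 𝟙 _) (y := 𝟙 _) (𝟙 _) (id : K → K) (id : K → K)
        ?_ ?_ ?_).trans ?_
      · rw [const_ev, gmap_id]
      · rw [const_ev, gmap_id]
      · rw [Category.comp_id, Category.comp_id, lift_fst_snd, Category.id_comp]
      · rw [const_ev, whiskerRight_fst]
        rfl)

/-- The group `γ^*K` in `P_𝒰`. -/
noncomputable instance constMonObj (K : Type u) [Monoid K] : MonObj (const 𝒰 K) where
  one := constOne 𝒰 K
  mul := constMul 𝒰 K
  one_mul := by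
    ext1
    · rw [comp_f, whiskerRight_f, leftUnitor_f]
      exact MonObj.one_mul (C := E) ((gammaStar E).obj K)
    · funext i p
      exact one_mul (M := K) p.2
  mul_one := by
    ext1
    · rw [comp_f, whiskerLeft_f, rightUnitor_f]
      exact MonObj.mul_one (C := E) ((gammaStar E).obj K)
    · funext i p
      exact mul_one (M := K) p.1
  mul_assoc := by
    ext1
    · rw [comp_f, comp_f, comp_f, whiskerLeft_f, whiskerRight_f, associator_f]
      exact MonObj.mul_assoc (C := E) ((gammaStar E).obj K)
    · funext i p
      exact mul_assoc (G := K) p.1.1 p.1.2 p.2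

/-- The functor from `γ^*K`-objects of `P_𝒰` to `γ^*K`-objects of `E` that is induced
by the forgetful functor. -/
noncomputable def forgetMod (K : Type u) [Monoid K] :
    Mod (LocConst 𝒰) (const 𝒰 K) ⥤ Mod E ((gammaStar E).obj K) where
  obj T :=
    { X := T.X.X
      mod :=
        { smul := (ModObj.smul (M := const 𝒰 K) (X := T.X) : const 𝒰 K ⊗ T.X ⟶ T.X).f
          one_smul := by
            have h := congrArg Hom.f (ModObj.one_smul (M := const 𝒰 K) T.X)
            refine Eq.trans ?_ (h.trans (leftUnitor_f T.X))
            exact congrArg (· ≫ _) (whiskerRight_f (constOne 𝒰 K) T.X).symm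
          mul_smul := by
            have h := congrArg Hom.f (ModObj.mul_smul (M := const 𝒰 K) T.X)
            refine Eq.trans (congrArg (· ≫ _) (whiskerRight_f (constMul 𝒰 K) T.X).symm)
              (h.trans ?_)
            exact congr (congrArg _ (associator_f _ _ _)) (congrArg (· ≫ _) (whiskerLeft_f _ _)) } }
  map f := Mod.Hom.mk' f.hom.f (by
    have h := congrArg Hom.f (IsModHom.smul_hom (A := const 𝒰 K) (f := f.hom))
    exact h.trans (congrArg (· ≫ _) (whiskerLeft_f _ _)))

end LocConst

end

section

variable {E : Type w} [Category.{u} E] [IsGrothendieckTopos E] [CartesianMonoidalCategory E]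
  {K : Type u} [Monoid K]

/-- The cover `T ⟶ 1` given by a `K`-torsor. -/
abbrev selfCover (T : Mod E ((gammaStar E).obj K)) (hT : IsTorsor ((gammaStar E).obj K) T.X) :
    Cover E :=
  Cover.ofFamily (fun _ : PUnit.{u + 1} => T.X)
    (fun _ g h H => by
      have := hT.epi
      exact (cancel_epi (toUnit T.X)).1 (H PUnit.unit))

/-- The locally constant object `(T, K, ε)` that is split by `T` itself, where
`ε : γ^*K × T ⟶ T × T` sends `(x, t)` to `(x · t, t)`. -/
noncomputable abbrev selfSplit (T : Mod E ((gammaStar E).obj K))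
    (hT : IsTorsor ((gammaStar E).obj K) T.X) : LocConst (selfCover T hT) where
  X := T.X
  S _ := K
  θ _ :=
    have := hT.isIso
    asIso (lift (ModObj.smul (M := (gammaStar E).obj K) (X := T.X) :
      (gammaStar E).obj K ⊗ T.X ⟶ T.X) (snd _ _))
  comp_snd _ := lift_snd _ _

/-- The functor from `K`-torsors in `cG(E)` to `K`-torsors in `E` that is induced by the forgetful
functor, provided that the latter sends torsors to torsors. -/
noncomputable abbrev CovProj.forgetTorsor
    (h : ∀ T : TorsorCat (CovProj.const E K),
      IsTorsor ((gammaStar E).obj K) ((CovProj.forgetMod K).obj T.obj).X) :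
    TorsorCat (CovProj.const E K) ⥤ TorsorCat ((gammaStar E).obj K) :=
  ObjectProperty.lift _ (ObjectProperty.ι _ ⋙ CovProj.forgetMod K) h

end

end ToposTorsors

open ToposTorsors

namespace ToposTorsors

/-! ### Locally constant maps to `γ^*S` and the detection of nonempty objects -/

section

variable {E : Type w} [Category.{u} E] [IsGrothendieckTopos E]

/-! Everything is reduced to generalized elements. Over `u : C ⟶ U i` a trivialization assigns to
each `x : S i` a point `X.pt u x : C ⟶ X`. Every point of `X` over `U i` is locally of this form
(`ptSieve_mem`), and `x` is determined by the point as soon as `C` is nonempty (`pt_injective`). So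
the functions that lift an arrow `f` of `E` are determined by `f` (`hom_f_injective`), and they are
bijective when `f` is invertible. Equations, inverses and torsor structures can therefore be checked
in `E`.

In a torsor, any two points `t`, `t'` over `C` satisfy locally `t' = k · t` for a constant `k : K`,
because the first coordinate of `ε⁻¹(t', t)` is locally constant (`actSieve_mem`). Suppose each `S
i` is identified with `K` by a frame, that is, by a point `t` and a map `e` such that `e k` names `k
· t`. Then a change of frame is locally a right translation of `K`, hence a bijection commuting with
the left action. This gives the covering property (`isCoveringProjection_of_frames`), and the same
computation shows that every equivariant arrow lifts to functions locally
(`isLiftable_of_equivariant`).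

In `P_𝒰` a frame is the orbit of an element of `S i`, so each `S i` has to be nonempty. An
epimorphism `X ⟶ 1` of `P_𝒰` or `cG(E)` is tested only against locally constant targets. Targets
`γ^*2` are enough: the indicator of the part of `1` over which the fibres are empty is locally
constant, and it becomes zero on `X` (`LocConst.epi_toUnit`). Thus every `S i` is nonempty, and `X ⟶
1` is an epimorphism of `E`.

In part 3, chosen elements of the `S i` give points `U i ⟶ T`, which form the refinement `r`; the
orbit maps are functions lifting `id_T`. For the equivalence in part 1, fullness is the lifting of
equivariant arrows, and essential surjectivity is supplied by `(T, K, ε)`. -/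

instance effectiveEpi_of_epi {A B : E} (f : A ⟶ B) [Epi f] : EffectiveEpi f := by
  obtain ⟨C, _, J, ⟨e⟩⟩ := IsGrothendieckTopos.exists_site (E := E)
  -- Epimorphisms of sheaves of sets are regular, and effectiveness is reflected by the equivalence
  -- with sheaves.
  have : IsRegularEpi (e.functor.map f) := IsRegularEpiCategory.regularEpiOfEpi _
  have : EffectiveEpi (e.functor.map f) := inferInstance
  exact e.functor.effectiveEpi_of_map f inferInstance

lemma mem_epiTopology_of_not_isNonempty {A : E} (hA : ¬ IsNonempty A) (S : Sieve A) :
    S ∈ epiTopology E A :=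
  fun _ g h _ => hom_ext_of_not_isNonempty hA g h

/-- To be covering, it suffices to be covering locally on the nonempty members of a
covering sieve. -/
lemma mem_epiTopology_trans {A : E} {S R : Sieve A} (hS : S ∈ epiTopology E A)
    (H : ∀ ⦃D⦄ (d : D ⟶ A), S d → IsNonempty D → R.pullback d ∈ epiTopology E D) :
    R ∈ epiTopology E A := by
  refine (epiTopology E).transitive hS _ ?_
  intro D d hd
  by_cases hD : IsNonempty D
  · exact H d hd hD
  · exact mem_epiTopology_of_not_isNonempty hD _

variable [CartesianMonoidalCategory E]

/-- The constant point `x` of `γ^*S` at `C`. -/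
noncomputable def gconst (C : E) {S : Type u} (x : S) : C ⟶ (gammaStar E).obj S :=
  toUnit C ≫ gpt x

@[simp] lemma comp_gconst {C D : E} (d : D ⟶ C) {S : Type u} (x : S) :
    d ≫ gconst C x = gconst D x := by
  simp [gconst]

@[simp] lemma gconst_gmap (C : E) {S T : Type u} (s : S → T) (x : S) :
    gconst C x ≫ gmap s = gconst C (s x) := by
  simp [gconst]

/-- The places where a map to `γ^*S` is constant. -/
def constSieve {C : E} {S : Type u} (t : C ⟶ (gammaStar E).obj S) : Sieve C where
  arrows D d := ∃ x, d ≫ t = gconst D x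
  downward_closed := by
    rintro Y Z f ⟨x, hx⟩ g
    exact ⟨x, by rw [Category.assoc, hx, comp_gconst]⟩

/-- The coproduct injections of `γ^*S` are jointly epimorphic, and epimorphic sieves are stable
under pullback along `t`. -/
lemma constSieve_mem {C : E} {S : Type u} (t : C ⟶ (gammaStar E).obj S) :
    constSieve t ∈ epiTopology E C := by
  have h : constSieve (𝟙 ((gammaStar E).obj S)) ∈ epiTopology E _ := by
    intro Z g h H
    refine gamma_hom_ext fun x => H _ ⟨x, ?_⟩
    rw [Category.comp_id, gconst, toUnit_unique (toUnit (𝟙_ E)) (𝟙 _), Category.id_comp]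
  refine (epiTopology E).superset_covering ?_ ((epiTopology E).pullback_stable t h)
  rintro D d ⟨x, hx⟩
  exact ⟨x, by rwa [Category.comp_id] at hx⟩

/-- The copies of `C` indexed by `S` cover `γ^*S × C`, since the first projection is locally
constant. -/
lemma gamma_tensor_hom_ext {C Z : E} {S : Type u} {g h : (gammaStar E).obj S ⊗ C ⟶ Z}
    (H : ∀ x : S, lift (gconst C x) (𝟙 C) ≫ g = lift (gconst C x) (𝟙 C) ≫ h) : g = h := by
  refine constSieve_mem (fst ((gammaStar E).obj S) C) g h ?_
  rintro D d ⟨x, hx⟩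
  have : d = (d ≫ snd _ _) ≫ lift (gconst C x) (𝟙 C) := by
    ext <;> simp [hx]
  rw [this, Category.assoc, H, ← Category.assoc]

/-- Two distinct points of `S` have empty equalizer, and `γ^*` preserves this equalizer. Constants
that agree on `C` would give an arrow from `C` to `γ^*∅`, and every object with an arrow to an
initial object is initial. -/
lemma gconst_injective {C : E} (hC : IsNonempty C) {S : Type u} :
    Function.Injective (gconst C : S → _) := by
  intro x y hxy
  by_contra hne
  let a : PUnit.{u + 1} ⟶ S := ↾(fun _ => x)
  let b : PUnit.{u + 1} ⟶ S := ↾(fun _ => y)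
  let i : PEmpty.{u + 1} ⟶ PUnit.{u + 1} := ↾(fun z => z.elim)
  have w : i ≫ a = i ≫ b := by ext z; exact z.elim
  have hl : IsLimit (Fork.ofι i w) := by
    refine Fork.IsLimit.mk _ (fun s => ↾(fun z => ?_)) (fun s => ?_) (fun s m _ => ?_)
    · exact (hne (ConcreteCategory.congr_hom s.condition z)).elim
    · ext z
    · ext z
      exact (hne (ConcreteCategory.congr_hom s.condition z)).elim
  have hl' := isLimitForkMapOfIsLimit (gammaStar E) w hl
  have e : gconst C PUnit.unit ≫ (gammaStar E).map a =
      gconst C PUnit.unit ≫ (gammaStar E).map b :=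
    (gconst_gmap C (fun _ : PUnit.{u + 1} => x) PUnit.unit).trans
      (hxy.trans (gconst_gmap C (fun _ : PUnit.{u + 1} => y) PUnit.unit).symm)
  refine not_isNonempty_of_hom (Fork.IsLimit.lift hl' _ e) ?_ hC
  rw [IsNonempty, not_isEmpty_iff]
  exact ⟨IsInitial.ofUniqueHom (fun Z => Sigma.desc (fun z : PEmpty => z.elim))
    (fun Z m => gamma_hom_ext (fun z : PEmpty => z.elim))⟩

/-- A covering sieve with only empty members could not distinguish the two constants in `γ^*2`. The
lemma produces an actual element of a set from data that exist only locally. -/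
lemma exists_nonempty_of_mem {C : E} (hC : IsNonempty C) {S : Sieve C}
    (hS : S ∈ epiTopology E C) : ∃ (D : E) (d : D ⟶ C), S d ∧ IsNonempty D := by
  by_contra! H
  have : gconst C (ULift.up.{u} false) = gconst C (ULift.up.{u} true) :=
    hS _ _ (fun D d hd => hom_ext_of_not_isNonempty (H D d hd) _ _)
  simpa using gconst_injective hC this

end

/-! ### Points of locally constant objects -/

section

variable {E : Type w} [Category.{u} E] [IsGrothendieckTopos E] [CartesianMonoidalCategory E]

namespace LocConst

variable {𝒰 𝒱 : Cover E}

/-- The point of `X` over `u : C ⟶ U i` that corresponds to `x : S i`. -/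
noncomputable def pt (X : LocConst 𝒰) {C : E} {i : 𝒰.I} (u : C ⟶ 𝒰.U i) (x : X.S i) : C ⟶ X.X :=
  lift (gconst C x) (𝟙 C) ≫ X.ev u

lemma comp_pt (X : LocConst 𝒰) {C D : E} {i : 𝒰.I} (d : D ⟶ C) (u : C ⟶ 𝒰.U i) (x : X.S i) :
    d ≫ X.pt u x = X.pt (d ≫ u) x := by
  rw [pt, pt, ← whisker_ev, ← Category.assoc, ← Category.assoc]
  congr 1
  ext <;> simp

/-- Compatibility of `f` with a function on fibres becomes a condition on single elements, because
the constant points cover `γ^*(S i) × C`. The two objects may be split by different covers, as is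
needed in `cG(E)`. -/
lemma ev_eq_iff {X : LocConst 𝒰} {Y : LocConst 𝒱} {C : E} {i : 𝒰.I} {j : 𝒱.I}
    {u : C ⟶ 𝒰.U i} {v : C ⟶ 𝒱.U j} {f : X.X ⟶ Y.X} {s : X.S i → Y.S j} :
    X.ev u ≫ f = gmap s ▷ C ≫ Y.ev v ↔ ∀ x, X.pt u x ≫ f = Y.pt v (s x) := by
  have h (x : X.S i) : lift (gconst C x) (𝟙 C) ≫ gmap s ▷ C = lift (gconst C (s x)) (𝟙 C) := by
    ext <;> simp
  constructor
  · intro H x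
    rw [pt, Category.assoc, H, reassoc_of% h x, pt]
  · intro H
    refine gamma_tensor_hom_ext fun x => ?_
    rw [reassoc_of% h x]
    simpa [pt] using H x

lemma ev_eq_iff' {X : LocConst 𝒰} {C : E} {i j : 𝒰.I} {u : C ⟶ 𝒰.U i} {v : C ⟶ 𝒰.U j}
    {s : X.S i → X.S j} :
    X.ev u = gmap s ▷ C ≫ X.ev v ↔ ∀ x, X.pt u x = X.pt v (s x) := by
  simpa using ev_eq_iff (X := X) (Y := X) (u := u) (v := v) (f := 𝟙 _) (s := s)

lemma hom_pt {X Y : LocConst 𝒰} (F : X ⟶ Y) {C : E} {i : 𝒰.I} (u : C ⟶ 𝒰.U i) (x : X.S i) :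
    X.pt u x ≫ F.f = Y.pt u (F.ϑ i x) :=
  ev_eq_iff.1 (hom_ev F u) x

/-- The places where `t : C ⟶ X` is given by an element of `S i`. -/
def ptSieve (X : LocConst 𝒰) {C : E} {i : 𝒰.I} (u : C ⟶ 𝒰.U i) (t : C ⟶ X.X) : Sieve C where
  arrows D d := ∃ x, d ≫ t = X.pt (d ≫ u) x
  downward_closed := by
    rintro Y Z f ⟨x, hx⟩ g
    exact ⟨x, by rw [Category.assoc, hx, comp_pt, Category.assoc]⟩

/-- The inverse trivialization carries the section `(t, 1)` of `X × C` to a section of `γ^*(S i) ×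
C`, whose first coordinate is locally constant. -/
lemma ptSieve_mem (X : LocConst 𝒰) {C : E} {i : 𝒰.I} (u : C ⟶ 𝒰.U i) (t : C ⟶ X.X) :
    X.ptSieve u t ∈ epiTopology E C := by
  refine (epiTopology E).superset_covering ?_
    (constSieve_mem (lift t (𝟙 C) ≫ (X.evIso u).inv ≫ fst _ _))
  rintro D d ⟨x, hx⟩
  refine ⟨x, ?_⟩
  have h : lift t (𝟙 C) ≫ (X.evIso u).inv =
      lift (lift t (𝟙 C) ≫ (X.evIso u).inv ≫ fst _ _) (𝟙 C) := by
    ext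
    · simp
    · have : (X.evIso u).inv ≫ snd _ _ = snd _ _ := by rw [Iso.inv_comp_eq, evIso_snd]
      simp [this]
  have h' : t = lift t (𝟙 C) ≫ (X.evIso u).inv ≫ X.ev u := by
    rw [← evIso_fst, Iso.inv_hom_id_assoc, lift_fst]
  have e : d ≫ lift (lift t (𝟙 C) ≫ (X.evIso u).inv ≫ fst _ _) (𝟙 C) =
      d ≫ lift (gconst C x) (𝟙 C) := by
    ext
    · rw [Category.assoc, lift_fst, hx, Category.assoc, lift_fst, comp_gconst]
    · simp
  rw [← comp_pt, pt, ← reassoc_of% e, ← h, Category.assoc, ← h']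

lemma pt_injective (X : LocConst 𝒰) {C : E} (hC : IsNonempty C) {i : 𝒰.I} (u : C ⟶ 𝒰.U i) :
    Function.Injective (X.pt u) := by
  intro x y h
  have := X.ev_ext u h (by simp) =≫ fst _ _
  rw [lift_fst, lift_fst] at this
  exact gconst_injective hC this

/-- The members of a cover are nonempty, so an element of `Y.S i` is determined by its point over `U
i`. Hence `P_𝒰 ⥤ E` is faithful, and equations in `P_𝒰` reduce to equations in `E`. -/
lemma hom_f_injective {X Y : LocConst 𝒰} {F G : X ⟶ Y} (h : F.f = G.f) : F = G := by
  refine hom_ext h ?_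
  funext i x
  apply Y.pt_injective (𝒰.nonempty i) (𝟙 _)
  rw [← hom_pt, ← hom_pt, h]

lemma const_pt (K : Type u) {C : E} {i : 𝒰.I} (u : C ⟶ 𝒰.U i) (k : K) :
    (const 𝒰 K).pt u k = gconst C k :=
  (congrArg (_ ≫ ·) (const_ev K u)).trans (lift_fst _ _)

lemma pull_pt (r : Refinement 𝒰 𝒱) (X : LocConst 𝒱) {C : E} {i : 𝒰.I} (u : C ⟶ 𝒰.U i)
    (x : X.S (r.α i)) : (X.pull r).pt u x = X.pt (u ≫ r.h i) x :=
  congrArg (_ ≫ ·) (pull_ev r X u)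

lemma prod_pt (X Y : LocConst 𝒰) {C : E} {i : 𝒰.I} (u : C ⟶ 𝒰.U i) (p : X.S i × Y.S i) :
    (X.prod Y).pt u p = lift (X.pt u p.1) (Y.pt u p.2) := by
  refine CartesianMonoidalCategory.hom_ext _ _ ?_ ?_
  · exact (hom_pt (homFst X Y) u p).trans (lift_fst _ _).symm
  · exact (hom_pt (homSnd X Y) u p).trans (lift_snd _ _).symm

/-- Functions that lift an isomorphism over a nonempty object are bijective. -/
lemma bijective_of_isIso {X : LocConst 𝒰} {Y : LocConst 𝒱} {C : E} (hC : IsNonempty C)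
    {i : 𝒰.I} {j : 𝒱.I} {u : C ⟶ 𝒰.U i} {v : C ⟶ 𝒱.U j} (f : X.X ⟶ Y.X) [IsIso f]
    {s : X.S i → Y.S j} (h : ∀ x, X.pt u x ≫ f = Y.pt v (s x)) : Function.Bijective s := by
  constructor
  · intro x y hxy
    apply X.pt_injective hC u
    rw [← cancel_mono f, h, h, hxy]
  · intro y
    -- The preimage of the point named `y` is named by some `x`, though only after restriction to a
    -- nonempty `D`. This suffices, because elements of `Y.S j` are already separated over `D`.
    obtain ⟨D, d, ⟨x, hx⟩, hD⟩ :=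
      exists_nonempty_of_mem hC (X.ptSieve_mem u (Y.pt v y ≫ inv f))
    refine ⟨x, Y.pt_injective hD (d ≫ v) ?_⟩
    rw [← comp_pt, ← h, reassoc_of% (X.comp_pt d u x), ← hx]
    simp [comp_pt]

/-- The functions lifting an isomorphism are bijective, and their inverses lift the inverse arrow.
-/
lemma isIso_of_isIso_f {X Y : LocConst 𝒰} (F : X ⟶ Y) [IsIso F.f] : IsIso F := by
  have hb i := bijective_of_isIso (𝒰.nonempty i) F.f (hom_pt F (𝟙 _))
  let G : Y ⟶ X := mkHom (inv F.f) (fun i => (Equiv.ofBijective _ (hb i)).symm) (fun i => by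
    rw [ev_eq_iff]
    intro y
    rw [IsIso.comp_inv_eq, hom_pt]
    exact congrArg _ ((Equiv.ofBijective _ (hb i)).apply_symm_apply y).symm)
  exact ⟨G, hom_f_injective (by simp [G]), hom_f_injective (by simp [G])⟩

end LocConst

/-! ### Global support of locally constant objects -/

/-- Gluing of constant maps on a cover. -/
lemma exists_unit_hom (𝒰 : Cover E) {S : Type u} (b : 𝒰.I → S)
    (hb : ∀ i j, IsNonempty (𝒰.U i ⊗ 𝒰.U j) → b i = b j) :
    ∃ φ : 𝟙_ E ⟶ (gammaStar E).obj S, ∀ i, toUnit (𝒰.U i) ≫ φ = gconst _ (b i) := by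
  let p : ∐ 𝒰.U ⟶ 𝟙_ E := Sigma.desc (fun i => toUnit (𝒰.U i))
  let k : ∐ 𝒰.U ⟶ (gammaStar E).obj S := Sigma.desc (fun i => gconst _ (b i))
  have : Epi p := ⟨fun g h H => 𝒰.epi g h (fun i => by
    simpa [p] using Sigma.ι 𝒰.U i ≫= H)⟩
  let R : Sieve (∐ 𝒰.U) :=
    { arrows := fun D d => ∃ i, ∃ a : D ⟶ 𝒰.U i, a ≫ Sigma.ι 𝒰.U i = d
      downward_closed := by
        rintro Y Z _ ⟨i, a, rfl⟩ g
        exact ⟨i, g ≫ a, by simp⟩ }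
  have hR : R ∈ epiTopology E _ := fun Z g h H =>
    Sigma.hom_ext _ _ (fun i => H _ ⟨i, 𝟙 _, by simp⟩)
  -- Descent along the effective epimorphism `p` requires agreement on pairs of points with the same
  -- image in `1`. Locally such a pair lies in some `U i × U j`; where this is nonempty `hb`
  -- applies, and elsewhere there is nothing to compare.
  have hk {Z : E} (g₁ g₂ : Z ⟶ ∐ 𝒰.U) (_ : g₁ ≫ p = g₂ ≫ p) : g₁ ≫ k = g₂ ≫ k := by
    refine (epiTopology E).intersection_covering ((epiTopology E).pullback_stable g₁ hR)
      ((epiTopology E).pullback_stable g₂ hR) _ _ ?_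
    rintro D d ⟨⟨i, a₁, h₁⟩, ⟨j, a₂, h₂⟩⟩
    by_cases hD : IsNonempty D
    · rw [← Category.assoc, ← Category.assoc, ← h₁, ← h₂]
      simp [k, hb i j (hD.of_hom (lift a₁ a₂))]
    · exact hom_ext_of_not_isNonempty hD _ _
  refine ⟨EffectiveEpi.desc p k hk, fun i => ?_⟩
  have hp : Sigma.ι 𝒰.U i ≫ p = toUnit _ := toUnit_unique _ _
  rw [← hp, Category.assoc, EffectiveEpi.fac]
  simp [k]

/-- A locally constant object has global support if it cannot be told from the terminal object by
locally constant maps to `γ^*2`. -/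
lemma LocConst.epi_toUnit {𝒰 : Cover E} (X : LocConst 𝒰)
    (H : ∀ (φ : 𝟙_ E ⟶ (gammaStar E).obj (ULift.{u} Bool)) (b : 𝒰.I → ULift.{u} Bool),
      (∀ i, toUnit (𝒰.U i) ≫ φ = gconst _ (b i)) →
      toUnit X.X ≫ φ = toUnit X.X ≫ gpt ⟨false⟩ → φ = gpt ⟨false⟩) :
    Epi (toUnit X.X) ∧ ∀ i, Nonempty (X.S i) := by
  classical
  -- The value is true exactly where the fibre is empty.
  let b : 𝒰.I → ULift.{u} Bool := fun i => ⟨decide (IsEmpty (X.S i))⟩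
  have hb (i) (h : Nonempty (X.S i)) : b i = ⟨false⟩ := by simp [b]
  -- An element of `S i` names a point of `X` over `U i × U j`, and on some nonempty object this
  -- point is also named by an element of `S j`. Emptiness of the fibre is thus constant along
  -- overlaps, so `b` glues.
  have key (i j) (h : IsNonempty (𝒰.U i ⊗ 𝒰.U j)) (hi : Nonempty (X.S i)) : Nonempty (X.S j) := by
    obtain ⟨x⟩ := hi
    obtain ⟨D, d, ⟨y, -⟩, -⟩ := exists_nonempty_of_mem h (X.ptSieve_mem (snd _ _) (X.pt (fst _ _) x))
    exact ⟨y⟩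
  obtain ⟨φ, hφ⟩ := exists_unit_hom 𝒰 b (fun i j h => by
    have h' : IsNonempty (𝒰.U j ⊗ 𝒰.U i) := h.of_hom (lift (snd _ _) (fst _ _))
    have := (iff_iff_eq.1 ⟨key i j h, key j i h'⟩)
    simp only [b, ← not_nonempty_iff, this])
  have hφ' : φ = gpt ⟨false⟩ := by
    refine H φ b hφ ?_
    -- Wherever `X` has a point over `U i`, that point is locally named by an element of `S i`.
    -- Hence the glued indicator is false over `X`.
    refine (epiTopology E).pullback_stable (toUnit X.X) 𝒰.sieve_mem _ _ ?_
    rintro D d ⟨i, ⟨w⟩⟩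
    refine X.ptSieve_mem w d _ _ ?_
    rintro D' d' ⟨x, -⟩
    have h₁ := (d' ≫ w) ≫= hφ i
    rw [hb i ⟨x⟩, comp_gconst, comp_toUnit_assoc] at h₁
    simpa [gconst] using h₁
  have hne (i) : Nonempty (X.S i) := by
    have h₁ := hφ i
    rw [hφ'] at h₁
    have := gconst_injective (𝒰.nonempty i) h₁
    simpa [b, eq_comm] using this
  -- With nonempty fibres each `U i` has a point of `X`, so the epimorphic family `U i ⟶ 1` factors
  -- through `X ⟶ 1`.
  refine ⟨⟨fun g h e => 𝒰.epi _ _ (fun i => ?_)⟩, hne⟩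
  obtain ⟨x⟩ := hne i
  have := X.pt (𝟙 (𝒰.U i)) x ≫= e
  rwa [comp_toUnit_assoc, comp_toUnit_assoc] at this

/-- A map `1 ⟶ γ^*2` that is constant on each `U i` is an arrow of `P_𝒰`. An epimorphism of `P_𝒰`
can therefore be cancelled against it, which is all that the criterion needs. -/
lemma LocConst.epi_toUnit_of_epi {𝒰 : Cover E} (X : LocConst 𝒰) (hX : Epi (toUnit X)) :
    Epi (toUnit X.X) ∧ ∀ i, Nonempty (X.S i) := by
  refine X.epi_toUnit fun φ b hφ e => ?_
  let F : unit 𝒰 ⟶ const 𝒰 (ULift.{u} Bool) := mkHom φ (fun i _ => b i) (fun i => by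
    refine (ev_eq_iff (X := unit 𝒰) (Y := const 𝒰 _)).2 fun x => ?_
    rw [const_pt, ← hφ, toUnit_unique (toUnit (𝒰.U i)) ((unit 𝒰).pt (𝟙 (𝒰.U i)) x)])
  let G : unit 𝒰 ⟶ const 𝒰 (ULift.{u} Bool) := mkHom (gpt ⟨false⟩) (fun i _ => ⟨false⟩)
    (fun i => by
      refine (ev_eq_iff (X := unit 𝒰) (Y := const 𝒰 _)).2 fun x => ?_
      rw [const_pt, gconst, toUnit_unique (toUnit (𝒰.U i)) ((unit 𝒰).pt (𝟙 (𝒰.U i)) x)])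
  have hFG : F = G := (cancel_epi (Z := const 𝒰 (ULift.{u} Bool)) (toUnit X)).1
    (hom_f_injective (by
      have h : Hom.f (toUnit X) = toUnit X.X := toUnit_unique (C := E) _ _
      exact (congrArg (· ≫ φ) h).trans (e.trans (congrArg (· ≫ gpt _) h.symm))))
  exact congrArg Hom.f hFG

namespace CovProj

lemma epi_toUnit_of_epi (X : CovProj E) (hX : Epi (toUnit X)) :
    Epi (toUnit X.obj.X) ∧ ∀ i, Nonempty (X.obj.S i) := by
  refine X.obj.epi_toUnit fun φ b hφ e => ?_
  -- The terminal object and `γ^*2` are split by the trivial cover. A map constant on the members of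
  -- `X.cover` lifts after refining to that cover.
  have hl (ψ : 𝟙_ E ⟶ (gammaStar E).obj (ULift.{u} Bool)) (c : X.cover.I → ULift.{u} Bool)
      (hψ : ∀ i, toUnit (X.cover.U i) ≫ ψ = gconst _ (c i)) :
      IsLiftable (unit E) (const E (ULift.{u} Bool)) ψ :=
    isLiftable_of_cover X.cover (fun k hk => by
      have h1 : IsNonempty (𝟙_ E) := hk.of_hom (toUnit _)
      refine ⟨⟨PUnit.unit, h1⟩, ⟨PUnit.unit, h1⟩, toUnit _, toUnit _, fun _ => c k, ?_⟩
      refine (LocConst.ev_eq_iff (X := (unit E).obj) (Y := (const E _).obj)).2 fun x => ?_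
      refine Eq.trans ?_ (LocConst.const_pt _ _ _).symm
      rw [← hψ]
      exact congrArg (· ≫ ψ) (toUnit_unique _ _))
  let F : unit E ⟶ const E (ULift.{u} Bool) := ⟨φ, hl φ b hφ⟩
  let G : unit E ⟶ const E (ULift.{u} Bool) := ⟨gpt ⟨false⟩, hl _ (fun _ => ⟨false⟩) fun _ => rfl⟩
  have hFG : F = G := (cancel_epi (Z := const E (ULift.{u} Bool)) (toUnit X)).1
    (hom_ext (by
      have h : Hom.f (toUnit X) = toUnit X.obj.X := toUnit_unique (C := E) _ _
      exact (congrArg (· ≫ φ) h).trans (e.trans (congrArg (· ≫ gpt _) h.symm))))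
  exact congrArg Hom.f hFG

/-- Wherever `F.f` lifts to a function over a nonempty object, that function is bijective. The same
places serve to lift the inverse. -/
lemma isIso_of_isIso_f {X Y : CovProj E} (F : X ⟶ Y) [IsIso F.f] : IsIso F := by
  have hl : IsLiftable Y X (inv F.f) := by
    have hF := F.isLiftable
    rw [isLiftable_iff] at hF ⊢
    refine (epiTopology E).superset_covering ?_ hF
    intro C c h hC
    obtain ⟨i, j, u, v, s, hs⟩ := h hC
    rw [LocConst.ev_eq_iff] at hs
    have hb := LocConst.bijective_of_isIso hC F.f hs
    refine ⟨j, i, v, u, (Equiv.ofBijective _ hb).symm, ?_⟩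
    rw [LocConst.ev_eq_iff]
    intro y
    rw [IsIso.comp_inv_eq, hs]
    exact congrArg _ ((Equiv.ofBijective _ hb).apply_symm_apply y).symm
  exact ⟨⟨inv F.f, hl⟩, hom_ext (IsIso.hom_inv_id F.f), hom_ext (IsIso.inv_hom_id F.f)⟩

end CovProj

end

/-! ### The action of `K` on points of a torsor -/

section

variable {E : Type w} [Category.{u} E] [IsGrothendieckTopos E] [CartesianMonoidalCategory E]
  {K : Type u} [Group K]

lemma lift_gconst_gmul (C : E) {S T : Type u} (x : S) (y : T) :
    lift (gconst C x) (gconst C y) ≫ gmul S T = gconst C (x, y) := by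
  apply gprod_ext <;> simp

/-- The result of letting `k` act on a point of a `γ^*K`-object. -/
noncomputable def gact {T : E} [ModObj ((gammaStar E).obj K) T] {C : E} (k : K) (t : C ⟶ T) :
    C ⟶ T :=
  lift (gconst C k) t ≫ (ModObj.smul (M := (gammaStar E).obj K) (X := T) :
    (gammaStar E).obj K ⊗ T ⟶ T)

section

variable {T : E} [ModObj ((gammaStar E).obj K) T]

lemma comp_gact {C D : E} (d : D ⟶ C) (k : K) (t : C ⟶ T) :
    d ≫ gact k t = gact k (d ≫ t) := by
  rw [gact, gact, comp_lift_assoc, comp_gconst]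

lemma gact_gact {C : E} (k l : K) (t : C ⟶ T) : gact k (gact l t) = gact (k * l) t := by
  have h : MonObj.mul (X := (gammaStar E).obj K) ▷ T ≫ (ModObj.smul (M := (gammaStar E).obj K)
      (X := T) : (gammaStar E).obj K ⊗ T ⟶ T) = (α_ _ _ _).hom ≫ _ ◁ ModObj.smul
        (M := (gammaStar E).obj K) (X := T) ≫ ModObj.smul (M := (gammaStar E).obj K) (X := T) :=
    ModObj.mul_smul (M := (gammaStar E).obj K) T
  have h₁ := lift (lift (gconst C k) (gconst C l)) t ≫= h
  have h₂ : lift (gconst C k) (gconst C l) ≫ MonObj.mul (X := (gammaStar E).obj K) =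
      gconst C (k * l) := by
    change _ ≫ gmul K K ≫ gmap _ = _
    rw [← Category.assoc, lift_gconst_gmul, gconst_gmap]
  rw [lift_whiskerRight_assoc, h₂, lift_lift_associator_hom_assoc,
    lift_whiskerLeft_assoc] at h₁
  exact h₁.symm

lemma gact_comp {T' : E} [ModObj ((gammaStar E).obj K) T'] (f : T ⟶ T')
    [IsModHom ((gammaStar E).obj K) f] {C : E} (k : K) (t : C ⟶ T) :
    gact k t ≫ f = gact k (t ≫ f) := by
  have h : (ModObj.smul (M := (gammaStar E).obj K) (X := T) : (gammaStar E).obj K ⊗ T ⟶ T) ≫ f =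
      _ ◁ f ≫ ModObj.smul (M := (gammaStar E).obj K) (X := T') :=
    IsModHom.smul_hom
  rw [gact, Category.assoc, h, lift_whiskerLeft_assoc]
  rfl

/-- Freeness of the action: `ε` is a monomorphism, and distinct constants differ on a nonempty
object. -/
lemma gact_injective (hT : IsTorsor ((gammaStar E).obj K) T) {C : E} (hC : IsNonempty C)
    (t : C ⟶ T) : Function.Injective (fun k : K => gact k t) := by
  intro k l h
  have := hT.isIso
  have h' : lift (gconst C k) t = lift (gconst C l) t := by
    rw [← cancel_mono (lift (ModObj.smul (M := (gammaStar E).obj K) (X := T) :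
      (gammaStar E).obj K ⊗ T ⟶ T) (snd _ _)), comp_lift, comp_lift, lift_snd, lift_snd]
    exact congrArg (lift · t) h
  have := h' =≫ fst _ _
  rw [lift_fst, lift_fst] at this
  exact gconst_injective hC this

/-- The places where two points of a `γ^*K`-object are related by an element of `K`. -/
def actSieve (K : Type u) [Group K] {T : E} [ModObj ((gammaStar E).obj K) T] {C : E}
    (t t' : C ⟶ T) : Sieve C where
  arrows D d := ∃ k : K, d ≫ t' = gact k (d ≫ t)
  downward_closed := by
    rintro Y Z f ⟨k, hk⟩ g
    exact ⟨k, by rw [Category.assoc, hk, comp_gact, Category.assoc]⟩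

/-- Local transitivity: the element relating the two points is the first coordinate of `ε⁻¹(t', t)`,
a map to `γ^*K` and hence locally constant. -/
lemma actSieve_mem (hT : IsTorsor ((gammaStar E).obj K) T) {C : E} (t t' : C ⟶ T) :
    actSieve K t t' ∈ epiTopology E C := by
  let ε : (gammaStar E).obj K ⊗ T ⟶ T ⊗ T := lift (ModObj.smul (M := (gammaStar E).obj K)
    (X := T) : (gammaStar E).obj K ⊗ T ⟶ T) (snd _ _)
  have : IsIso ε := hT.isIso
  refine (epiTopology E).superset_covering ?_ (constSieve_mem (lift t' t ≫ inv ε ≫ fst _ _))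
  rintro D d ⟨k, hk⟩
  refine ⟨k, ?_⟩
  have h₁ : inv ε ≫ snd _ _ = snd _ _ := by rw [IsIso.inv_comp_eq, lift_snd]
  have h₂ : d ≫ lift t' t ≫ inv ε = lift (gconst D k) (d ≫ t) := by
    ext
    · simpa using hk
    · simp [h₁]
  have h₃ : t' = (lift t' t ≫ inv ε) ≫ ε ≫ fst _ _ := by simp
  rw [h₃, Category.assoc, ← Category.assoc, ← Category.assoc, Category.assoc d, h₂, lift_fst, gact]

lemma pointSieve_mem (hT : IsTorsor ((gammaStar E).obj K) T) :
    unitSieve (fun C => Nonempty (C ⟶ T)) (fun _ _ f ⟨t⟩ => ⟨f ≫ t⟩) ∈ epiTopology E (𝟙_ E) := by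
  have := hT.epi
  intro Z g h H
  exact (cancel_epi (toUnit T)).1 (H (toUnit T) ⟨𝟙 T⟩)

end

/-! ### Frames and torsors in `P_𝒰` -/

namespace LocConst

variable {𝒰 : Cover E}

/-- Functions that match the action on a point of a torsor are bijective. -/
lemma frame_bijective (X : LocConst 𝒰) [ModObj ((gammaStar E).obj K) X.X]
    (hT : IsTorsor ((gammaStar E).obj K) X.X) {C : E} (hC : IsNonempty C) {i : 𝒰.I}
    {u : C ⟶ 𝒰.U i} {t : C ⟶ X.X} {e : K → X.S i} (h : ∀ k, X.pt u (e k) = gact k t) :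
    Function.Bijective e := by
  constructor
  · intro k l hkl
    apply gact_injective hT hC t
    dsimp only
    rw [← h, ← h, hkl]
  · intro x
    -- Transitivity gives `k` only locally, but one nonempty `D` is enough to identify `e k` with
    -- `x`.
    obtain ⟨D, d, ⟨k, hk⟩, hD⟩ := exists_nonempty_of_mem hC (actSieve_mem hT t (X.pt u x))
    refine ⟨k, X.pt_injective hD (d ≫ u) ?_⟩
    rw [← comp_pt, ← comp_pt, hk, h, comp_gact]

/-- Locally on `U i × U j` the two base points satisfy `t = k · t'` with `k` constant. Then `l · t =
(l * k) · t'`, so in the frames the descent datum is right multiplication by `k`, which is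
bijective. -/
lemma isCoveringProjection_of_frames (X : LocConst 𝒰) [ModObj ((gammaStar E).obj K) X.X]
    (hT : IsTorsor ((gammaStar E).obj K) X.X)
    (H : ∀ i, ∃ (t : 𝒰.U i ⟶ X.X) (e : K → X.S i), ∀ k, X.pt (𝟙 _) (e k) = gact k t) :
    X.IsCoveringProjection := by
  rw [isCoveringProjection_iff]
  intro i j
  obtain ⟨t, e, h⟩ := H i
  obtain ⟨t', e', h'⟩ := H j
  have hb := X.frame_bijective hT (𝒰.nonempty i) h
  have hb' := X.frame_bijective hT (𝒰.nonempty j) h'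
  refine (epiTopology E).superset_covering ?_ (actSieve_mem hT (snd _ _ ≫ t') (fst _ _ ≫ t))
  rintro D d ⟨k, hk⟩
  refine ⟨fun x => e' ((Equiv.ofBijective _ hb).symm x * k),
    hb'.comp ((Equiv.mulRight k).bijective.comp (Equiv.bijective _)), ?_⟩
  rw [ev_eq_iff']
  intro x
  obtain ⟨l, rfl⟩ := hb.2 x
  have h₁ : (Equiv.ofBijective _ hb).symm (e l) = l := (Equiv.ofBijective _ hb).symm_apply_apply l
  have h₂ := (d ≫ fst _ _) ≫= h l
  have h₃ := (d ≫ snd _ _) ≫= h' (l * k)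
  rw [comp_pt, Category.comp_id, comp_gact, Category.assoc] at h₂ h₃
  rw [h₁, h₂, h₃, hk, gact_gact]

/-- The map `γ^*K × X ⟶ X` given by an action on the underlying object and functions that
lift it. -/
noncomputable def liftSMul (X : LocConst 𝒰) [ModObj ((gammaStar E).obj K) X.X]
    (ϑ : ∀ i, K × X.S i → X.S i)
    (h : ∀ i k x, gact k (X.pt (𝟙 (𝒰.U i)) x) = X.pt (𝟙 (𝒰.U i)) (ϑ i (k, x))) :
    const 𝒰 K ⊗ X ⟶ X :=
  mkHom (X := (const 𝒰 K).prod X)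
    (ModObj.smul (M := (gammaStar E).obj K) (X := X.X)) ϑ (fun i => by
      refine (ev_eq_iff (X := (const 𝒰 K).prod X) (Y := X)).2 fun x => ?_
      rw [← h, prod_pt, const_pt]
      rfl)

/-- The action on a locally constant object given by an action on the underlying object
and functions that lift it. -/
noncomputable abbrev modObj (X : LocConst 𝒰) [ModObj ((gammaStar E).obj K) X.X]
    (ϑ : ∀ i, K × X.S i → X.S i)
    (h : ∀ i k x, gact k (X.pt (𝟙 (𝒰.U i)) x) = X.pt (𝟙 (𝒰.U i)) (ϑ i (k, x))) :
    ModObj (const 𝒰 K) X where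
  smul := X.liftSMul ϑ h
  one_smul := by
    refine hom_f_injective ?_
    refine Eq.trans ?_ ((ModObj.one_smul (M := (gammaStar E).obj K) X.X).trans (leftUnitor_f X).symm)
    exact congrArg (· ≫ _) (whiskerRight_f (constOne 𝒰 K) X)
  mul_smul := by
    refine hom_f_injective ?_
    refine Eq.trans (congrArg (· ≫ _) (whiskerRight_f (constMul 𝒰 K) X))
      ((ModObj.mul_smul (M := (gammaStar E).obj K) X.X).trans ?_)
    change _ = (α_ (const 𝒰 K) (const 𝒰 K) X).hom.f ≫
      (const 𝒰 K ◁ X.liftSMul ϑ h).f ≫ (X.liftSMul ϑ h).f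
    rw [associator_f, whiskerLeft_f]
    rfl

lemma lift_f {X Y Z : LocConst 𝒰} (F : Z ⟶ X) (G : Z ⟶ Y) : (lift F G).f = lift F.f G.f :=
  f_ext ((congrArg Hom.f (lift_fst F G)).trans (lift_fst F.f G.f).symm)
    ((congrArg Hom.f (lift_snd F G)).trans (lift_snd F.f G.f).symm)

/-- The forgetful functor to `E` is faithful, hence reflects epimorphisms, and it reflects
isomorphisms. -/
lemma isTorsor_of_f (X : LocConst 𝒰) [ModObj (const 𝒰 K) X] [ModObj ((gammaStar E).obj K) X.X]
    (h : (ModObj.smul (M := const 𝒰 K) (X := X) : const 𝒰 K ⊗ X ⟶ X).f =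
      (ModObj.smul (M := (gammaStar E).obj K) (X := X.X) : (gammaStar E).obj K ⊗ X.X ⟶ X.X))
    (hT : IsTorsor ((gammaStar E).obj K) X.X) : IsTorsor (const 𝒰 K) X where
  epi := ⟨fun {Z} g g' e => by
    have := hT.epi
    refine hom_f_injective ((cancel_epi (toUnit X.X)).1 ?_)
    have h₀ : Hom.f (toUnit X) = toUnit X.X := toUnit_unique (C := E) _ _
    exact (congrArg (· ≫ g.f) h₀.symm).trans ((congrArg Hom.f e).trans (congrArg (· ≫ g'.f) h₀))⟩
  isIso := by
    have : IsIso (Hom.f (lift (ModObj.smul (M := const 𝒰 K) (X := X) : const 𝒰 K ⊗ X ⟶ X)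
        (snd _ _))) := by
      rw [lift_f, h]
      exact hT.isIso
    exact isIso_of_isIso_f _

/-- Invertibility of `ε` passes to underlying arrows. The epimorphism condition is the substantial
point, since `E` has more test objects than `P_𝒰`; it is settled by `epi_toUnit_of_epi`. -/
lemma isTorsor_forgetMod (T : Mod (LocConst 𝒰) (const 𝒰 K)) (hT : IsTorsor (const 𝒰 K) T.X) :
    IsTorsor ((gammaStar E).obj K) ((forgetMod K).obj T).X where
  epi := (T.X.epi_toUnit_of_epi hT.epi).1
  isIso := by
    let ε : const 𝒰 K ⊗ T.X ⟶ T.X ⊗ T.X :=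
      lift (ModObj.smul (M := const 𝒰 K) (X := T.X) : const 𝒰 K ⊗ T.X ⟶ T.X) (snd _ _)
    have : IsIso ε := hT.isIso
    have h : ε.f = lift (ModObj.smul (M := (gammaStar E).obj K) (X := ((forgetMod K).obj T).X) :
      (gammaStar E).obj K ⊗ ((forgetMod K).obj T).X ⟶ ((forgetMod K).obj T).X) (snd _ _) :=
      lift_f _ _
    rw [← h]
    exact ⟨(inv ε).f, congrArg Hom.f (IsIso.hom_inv_id ε), congrArg Hom.f (IsIso.inv_hom_id ε)⟩

lemma gact_pt (T : Mod (LocConst 𝒰) (const 𝒰 K)) {C : E} {i : 𝒰.I} (u : C ⟶ 𝒰.U i)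
    (k : K) (x : T.X.S i) :
    gact (T := ((forgetMod K).obj T).X) k (T.X.pt u x) = T.X.pt u
      (Hom.ϑ (ModObj.smul (M := const 𝒰 K) (X := T.X) : const 𝒰 K ⊗ T.X ⟶ T.X) i (k, x)) := by
  have h := hom_pt (ModObj.smul (M := const 𝒰 K) (X := T.X) : const 𝒰 K ⊗ T.X ⟶ T.X) u (k, x)
  rw [← h]
  have h₁ : LocConst.pt (const 𝒰 K ⊗ T.X) u (k, x) = lift (gconst C k) (T.X.pt u x) :=
    (prod_pt _ _ _ _).trans (congrArg (lift · _) (const_pt _ _ _))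
  exact (congrArg (· ≫ _) h₁).symm

end LocConst

/-! ### The torsor split by itself -/

lemma selfSplit_pt (T : Mod E ((gammaStar E).obj K)) (hT : IsTorsor ((gammaStar E).obj K) T.X)
    {C : E} {i : (selfCover T hT).I} (u : C ⟶ T.X) (k : K) :
    (selfSplit T hT).pt (i := i) u k = gact k u := by
  have h : (selfSplit T hT).ev (i := i) u = _ ◁ u ≫ (ModObj.smul (M := (gammaStar E).obj K)
      (X := T.X) : (gammaStar E).obj K ⊗ T.X ⟶ T.X) :=
    congrArg (_ ◁ u ≫ ·) (lift_fst _ _)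
  refine (congrArg (_ ≫ ·) h).trans ?_
  rw [lift_whiskerLeft_assoc, Category.id_comp]
  rfl

/-- The generic point `id_T` is a frame: over it, `k : K` names `k · id_T`. -/
lemma isCoveringProjection_selfSplit (T : Mod E ((gammaStar E).obj K))
    (hT : IsTorsor ((gammaStar E).obj K) T.X) : (selfSplit T hT).IsCoveringProjection :=
  (selfSplit T hT).isCoveringProjection_of_frames hT
    (fun _ => ⟨𝟙 T.X, id, fun k => selfSplit_pt T hT _ k⟩)

/-- Associativity `k · (x · t) = (k * x) · t` says exactly that the product of `K` lifts the action.
-/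
theorem exists_modObj_selfSplit (T : Mod E ((gammaStar E).obj K))
    (hT : IsTorsor ((gammaStar E).obj K) T.X) :
    ∃ M : ModObj (LocConst.const (selfCover T hT) K) (selfSplit T hT),
      IsTorsor (LocConst.const (selfCover T hT) K) (selfSplit T hT) ∧
      LocConst.Hom.f M.smul = T.mod.smul ∧
      ∀ i, LocConst.Hom.ϑ M.smul i = fun p : K × K => p.1 * p.2 := by
  let M := (selfSplit T hT).modObj (K := K) (fun _ (p : K × K) => p.1 * p.2) (fun i k x => by
    refine (congrArg (gact k) (selfSplit_pt T hT _ x)).trans ?_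
    rw [gact_gact]
    exact (selfSplit_pt T hT _ _).symm)
  exact ⟨M, (selfSplit T hT).isTorsor_of_f rfl hT, rfl, fun _ => rfl⟩

end

/-! ### Comparison of torsors in `P_𝒰` with `(T, K, ε)` -/

section

variable {E : Type w} [Category.{u} E] [IsGrothendieckTopos E] [CartesianMonoidalCategory E]
  {K : Type u} [Group K]

theorem locConst_torsor (𝒰 : Cover E) (T : Mod (LocConst 𝒰) (LocConst.const 𝒰 K))
    (h : IsTorsor (LocConst.const 𝒰 K) T.X) :
    T.X.IsCoveringProjection ∧
      ∃ (hT : IsTorsor ((gammaStar E).obj K) ((LocConst.forgetMod K).obj T).X)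
        (r : Refinement 𝒰 (selfCover ((LocConst.forgetMod K).obj T) hT))
        (M : ModObj (LocConst.const 𝒰 K)
          ((selfSplit ((LocConst.forgetMod K).obj T) hT).pull r))
        (e : CategoryTheory.Mod.mk (A := LocConst.const 𝒰 K)
          ((selfSplit ((LocConst.forgetMod K).obj T) hT).pull r) ≅ T),
        LocConst.Hom.f M.smul = LocConst.Hom.f T.mod.smul ∧
        (∀ i, LocConst.Hom.ϑ M.smul i = fun p : K × K => p.1 * p.2) ∧
        LocConst.Hom.f e.hom.hom = 𝟙 T.X.X := by
  let T₀ := (LocConst.forgetMod K).obj T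
  have hT : IsTorsor ((gammaStar E).obj K) T₀.X := LocConst.isTorsor_forgetMod T h
  let _ : ModObj ((gammaStar E).obj K) T.X.X := T₀.mod
  -- Global support provides an element in each fibre. Its orbit map `e i` is a frame, because the
  -- functions lifting the action match the action on points.
  let x (i : 𝒰.I) : T.X.S i := ((T.X.epi_toUnit_of_epi h.epi).2 i).some
  let a : LocConst.const 𝒰 K ⊗ T.X ⟶ T.X := ModObj.smul (M := LocConst.const 𝒰 K) (X := T.X)
  let e (i : 𝒰.I) (k : K) : T.X.S i := a.ϑ i (k, x i)
  have he (i : 𝒰.I) (k : K) : T.X.pt (𝟙 _) (e i k) = gact k (T.X.pt (𝟙 _) (x i)) :=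
    (LocConst.gact_pt T _ _ _).symm
  refine ⟨T.X.isCoveringProjection_of_frames hT fun i => ⟨_, e i, he i⟩, hT, ?_⟩
  let t (i : 𝒰.I) : 𝒰.U i ⟶ T₀.X := T.X.pt (𝟙 _) (x i)
  -- The only possible index of `selfCover` requires `T` to be nonempty; this holds because a
  -- nonempty `U i` maps to `T`. When `𝒰` is empty no index is needed.
  let r : Refinement 𝒰 (selfCover T₀ hT) :=
    ⟨fun i => ⟨PUnit.unit, (𝒰.nonempty i).of_hom (t i)⟩, t⟩
  let Y := (selfSplit T₀ hT).pull r
  have hY (i : 𝒰.I) (k : K) : Y.pt (𝟙 (𝒰.U i)) k = gact k (t i) := by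
    refine (LocConst.pull_pt r (selfSplit T₀ hT) (𝟙 (𝒰.U i)) k).trans ?_
    rw [Category.id_comp]
    exact selfSplit_pt T₀ hT _ _
  let _ : ModObj ((gammaStar E).obj K) Y.X := T₀.mod
  let M : ModObj (LocConst.const 𝒰 K) Y := Y.modObj (fun _ (p : K × K) => p.1 * p.2)
    (fun i k l => by
      refine (congrArg (gact k) (hY i l)).trans ?_
      rw [gact_gact]
      exact (hY i _).symm)
  -- Over `U i` the pulled-back trivialization names `k · t i` by `k`, whereas `T` names it by `e i
  -- k`. So the orbit maps lift the identity arrow.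
  let F : Y ⟶ T.X := LocConst.mkHom (𝟙 T.X.X) e (fun i => by
    refine (LocConst.ev_eq_iff (X := Y) (Y := T.X)).2 fun k => ?_
    refine (congrArg (· ≫ 𝟙 T.X.X) (hY i k)).trans ?_
    rw [he]
    exact Category.comp_id _)
  have : IsIso F.f := inferInstanceAs (IsIso (𝟙 T.X.X))
  have : IsIso F := LocConst.isIso_of_isIso_f F
  have : IsModHom (LocConst.const 𝒰 K) F := ⟨by
    refine LocConst.hom_f_injective ?_
    refine Eq.trans (Category.comp_id a.f) ?_
    refine Eq.trans ?_ (congrArg (· ≫ a.f) (LocConst.whiskerLeft_f (LocConst.const 𝒰 K) F)).symm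
    exact ((congrArg (· ≫ a.f) (MonoidalCategory.whiskerLeft_id _ _)).trans
      (Category.id_comp a.f)).symm⟩
  have : IsModHom (LocConst.const 𝒰 K) (asIso F).hom := this
  let e : CategoryTheory.Mod.mk (A := LocConst.const 𝒰 K) Y ≅ T :=
    { hom := { hom := F }
      inv := { hom := (asIso F).inv }
      hom_inv_id := Mod.hom_ext _ _ (asIso F).hom_inv_id
      inv_hom_id := Mod.hom_ext _ _ (asIso F).inv_hom_id }
  exact ⟨r, M, e, rfl, fun _ => rfl, rfl⟩

/-! ### Torsors in `cG(E)` and the equivalence -/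

namespace CovProj

lemma pt_prod (X Y : CovProj E) {C : E} {p : (X.cover.inter Y.cover).I}
    (u : C ⟶ (X.cover.inter Y.cover).U p) (q : X.obj.S p.1.1 × Y.obj.S p.1.2) :
    (X.prod Y).obj.pt u q =
      lift (X.obj.pt (u ≫ fst _ _) q.1) (Y.obj.pt (u ≫ snd _ _) q.2) := by
  refine (LocConst.prod_pt _ _ _ _).trans ?_
  rw [LocConst.pull_pt, LocConst.pull_pt]

lemma isTorsor_forgetMod (T : Mod (CovProj E) (const E K)) (hT : IsTorsor (const E K) T.X) :
    IsTorsor ((gammaStar E).obj K) ((forgetMod K).obj T).X where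
  epi := (T.X.epi_toUnit_of_epi hT.epi).1
  isIso := by
    let ε : const E K ⊗ T.X ⟶ T.X ⊗ T.X :=
      lift (ModObj.smul (M := const E K) (X := T.X) : const E K ⊗ T.X ⟶ T.X) (snd _ _)
    have : IsIso ε := hT.isIso
    have h : ε.f = lift (ModObj.smul (M := (gammaStar E).obj K) (X := ((forgetMod K).obj T).X) :
      (gammaStar E).obj K ⊗ ((forgetMod K).obj T).X ⟶ ((forgetMod K).obj T).X) (snd _ _) :=
      lift_f _ _
    rw [← h]
    exact ⟨(inv ε).f, congrArg Hom.f (IsIso.hom_inv_id ε), congrArg Hom.f (IsIso.inv_hom_id ε)⟩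

/-- A torsor in `cG(E)` is locally trivialized by points. -/
lemma exists_frames (X : CovProj E) [ModObj ((gammaStar E).obj K) X.obj.X]
    (hX : IsTorsor ((gammaStar E).obj K) X.obj.X) (a : const E K ⊗ X ⟶ X)
    (ha : a.f = (ModObj.smul (M := (gammaStar E).obj K) (X := X.obj.X) :
      (gammaStar E).obj K ⊗ X.obj.X ⟶ X.obj.X)) :
    ∃ R ∈ epiTopology E (𝟙_ E), ∀ ⦃C : E⦄ (c : C ⟶ 𝟙_ E), R c → IsNonempty C →
      ∃ (j : X.cover.I) (v : C ⟶ X.cover.U j) (t : C ⟶ X.obj.X) (e : K ≃ X.obj.S j),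
        ∀ k, X.obj.pt v (e k) = gact k t := by
  have hl := (isLiftable_iff _ _ _).1 a.isLiftable
  let Q : E → Prop := fun C => IsNonempty C →
    ∃ (j : X.cover.I) (v : C ⟶ X.cover.U j) (t : C ⟶ X.obj.X) (e : K ≃ X.obj.S j),
      ∀ k, X.obj.pt v (e k) = gact k t
  have hQ : ∀ ⦃A B : E⦄, (A ⟶ B) → Q B → Q A := by
    intro A B f h hA
    obtain ⟨j, v, t, e, h⟩ := h (hA.of_hom f)
    refine ⟨j, f ≫ v, f ≫ t, e, fun k => ?_⟩
    rw [← LocConst.comp_pt, h, comp_gact]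
  refine ⟨unitSieve Q hQ, ?_, fun C c h hC => h hC⟩
  refine mem_epiTopology_trans ((epiTopology E).intersection_covering hl (pointSieve_mem hX)) ?_
  rintro C c ⟨h₁, ⟨t⟩⟩ hC
  -- In `cG(E)` the action lifts to a function `s : K × S i → S j` whose two indices may differ.
  -- With `x : S i` naming the point `t` locally, the frame is `k ↦ s (k, x)`; it takes values in `S
  -- j`, so it is read over `v` and not over `u`.
  obtain ⟨p, j, u, v, s, hs⟩ := h₁ hC
  refine (epiTopology E).superset_covering ?_ (X.obj.ptSieve_mem (u ≫ snd _ _) t)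
  rintro D d ⟨x, hx⟩ hD
  rw [← Category.assoc] at hx
  have h (k : K) : X.obj.pt (d ≫ v) (s (k, x)) = gact k (d ≫ t) := by
    rw [← LocConst.comp_pt, ← LocConst.ev_eq_iff.1 hs, hx, ha]
    have h₂ := (LocConst.comp_pt _ d u _).trans (pt_prod (const E K) X (d ≫ u) (k, x))
    refine (Category.assoc _ _ _).symm.trans ((congrArg (· ≫ _) h₂).trans ?_)
    exact congrArg (fun z : D ⟶ (gammaStar E).obj K => lift z (X.obj.pt ((d ≫ u) ≫ snd _ _) x) ≫
      ModObj.smul (M := (gammaStar E).obj K) (X := X.obj.X)) (LocConst.const_pt _ _ _)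
  exact ⟨j, d ≫ v, d ≫ t, Equiv.ofBijective _ (X.obj.frame_bijective hX hD h), h⟩

/-- In local frames based at `t` and `t'` one has `f(t) = l · t'`, locally with `l` constant.
Equivariance gives `f(k · t) = (k * l) · t'`, so `f` lifts to right multiplication by `l`. -/
lemma isLiftable_of_equivariant (X Y : CovProj E) [ModObj ((gammaStar E).obj K) X.obj.X]
    [ModObj ((gammaStar E).obj K) Y.obj.X] (hX : IsTorsor ((gammaStar E).obj K) X.obj.X)
    (hY : IsTorsor ((gammaStar E).obj K) Y.obj.X) (a : const E K ⊗ X ⟶ X)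
    (ha : a.f = (ModObj.smul (M := (gammaStar E).obj K) (X := X.obj.X) :
      (gammaStar E).obj K ⊗ X.obj.X ⟶ X.obj.X)) (b : const E K ⊗ Y ⟶ Y)
    (hb : b.f = (ModObj.smul (M := (gammaStar E).obj K) (X := Y.obj.X) :
      (gammaStar E).obj K ⊗ Y.obj.X ⟶ Y.obj.X))
    (f : X.obj.X ⟶ Y.obj.X) [IsModHom ((gammaStar E).obj K) f] : IsLiftable X Y f := by
  obtain ⟨R, hR, h⟩ := exists_frames X hX a ha
  obtain ⟨R', hR', h'⟩ := exists_frames Y hY b hb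
  rw [isLiftable_iff]
  refine mem_epiTopology_trans ((epiTopology E).intersection_covering hR hR') ?_
  rintro C c ⟨hc, hc'⟩ hC
  obtain ⟨i, u, t, e, he⟩ := h c hc hC
  obtain ⟨j, v, t', e', he'⟩ := h' c hc' hC
  refine (epiTopology E).superset_covering ?_ (actSieve_mem hY t' (t ≫ f))
  rintro D d ⟨l, hl⟩ hD
  refine ⟨i, j, d ≫ u, d ≫ v, fun x => e' (e.symm x * l), ?_⟩
  rw [LocConst.ev_eq_iff]
  intro x
  obtain ⟨k, rfl⟩ := e.surjective x
  rw [e.symm_apply_apply, ← LocConst.comp_pt, ← LocConst.comp_pt, he, he', Category.assoc,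
    gact_comp, comp_gact, comp_gact, hl, gact_gact]

/-- The action on a covering projection given by a liftable action on the underlying object. -/
noncomputable abbrev modObj (X : CovProj E) [ModObj ((gammaStar E).obj K) X.obj.X]
    (a : const E K ⊗ X ⟶ X)
    (ha : a.f = (ModObj.smul (M := (gammaStar E).obj K) (X := X.obj.X) :
      (gammaStar E).obj K ⊗ X.obj.X ⟶ X.obj.X)) :
    ModObj (const E K) X where
  smul := a
  one_smul := by
    refine hom_ext ?_
    refine Eq.trans ?_
      ((ModObj.one_smul (M := (gammaStar E).obj K) X.obj.X).trans (leftUnitor_f X).symm)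
    exact congr (congrArg (· ≫ ·) (whiskerRight_f (constOne K) X)) ha
  mul_smul := by
    refine hom_ext ?_
    change (constMul K ▷ X).f ≫ a.f = (α_ (const E K) (const E K) X).hom.f ≫ (const E K ◁ a).f ≫ a.f
    rw [associator_f, whiskerLeft_f, whiskerRight_f, ha]
    exact ModObj.mul_smul (M := (gammaStar E).obj K) X.obj.X

/-- A torsor in `E`, as a covering projection. -/
noncomputable abbrev ofTorsor (T : Mod E ((gammaStar E).obj K))
    (hT : IsTorsor ((gammaStar E).obj K) T.X) : CovProj E :=
  ⟨selfCover T hT, selfSplit T hT, isCoveringProjection_selfSplit T hT⟩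

/-- The action on a torsor in `E`, as a map of covering projections. -/
noncomputable def ofTorsorSMul (T : Mod E ((gammaStar E).obj K))
    (hT : IsTorsor ((gammaStar E).obj K) T.X) :
    const E K ⊗ ofTorsor T hT ⟶ ofTorsor T hT where
  f := (ModObj.smul (M := (gammaStar E).obj K) (X := T.X))
  isLiftable := isLiftable_of_cover ((Cover.trivial E).inter (selfCover T hT)) (fun p _ => by
    -- Over the second projection to `T`, the element `q.2` names `q.2 · t`, so acting by `q.1`
    -- gives the point named by `q.1 * q.2`.
    refine ⟨p, p.1.2, 𝟙 _, snd _ _, fun q : K × K => q.1 * q.2, ?_⟩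
    refine (LocConst.ev_eq_iff (X := ((const E K).prod (ofTorsor T hT)).obj)
      (Y := selfSplit T hT)).2 fun q => ?_
    refine Eq.trans ?_ (selfSplit_pt T hT _ _).symm
    refine Eq.trans ?_ (gact_gact (T := T.X) q.1 q.2 _)
    refine congrArg (· ≫ _) ((pt_prod (const E K) (ofTorsor T hT) _ q).trans ?_)
    rw [Category.id_comp]
    refine congr (congrArg lift (LocConst.const_pt _ _ _)) ?_
    rw [Category.id_comp]
    exact selfSplit_pt T hT _ _)

lemma isTorsor_of_f (X : CovProj E) [ModObj (const E K) X] [ModObj ((gammaStar E).obj K) X.obj.X]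
    (h : (ModObj.smul (M := const E K) (X := X) : const E K ⊗ X ⟶ X).f =
      (ModObj.smul (M := (gammaStar E).obj K) (X := X.obj.X) :
        (gammaStar E).obj K ⊗ X.obj.X ⟶ X.obj.X))
    (hT : IsTorsor ((gammaStar E).obj K) X.obj.X) : IsTorsor (const E K) X where
  epi := ⟨fun {Z} g g' e => by
    have := hT.epi
    refine hom_ext ((cancel_epi (toUnit X.obj.X)).1 ?_)
    have h₀ : Hom.f (toUnit X) = toUnit X.obj.X := toUnit_unique (C := E) _ _
    exact (congrArg (· ≫ g.f) h₀.symm).trans ((congrArg Hom.f e).trans (congrArg (· ≫ g'.f) h₀))⟩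
  isIso := by
    have : IsIso (Hom.f (lift (ModObj.smul (M := const E K) (X := X) : const E K ⊗ X ⟶ X)
        (snd _ _))) := by
      rw [lift_f, h]
      exact hT.isIso
    exact isIso_of_isIso_f _

/-- Arrows of `cG(E)` are arrows of `E` with a property, so faithfulness is immediate and fullness
is `isLiftable_of_equivariant`. For essential surjectivity, `ofTorsor` has the given torsor itself
as its image. -/
theorem forgetTorsor_isEquivalence :
    (forgetTorsor (E := E) (K := K) (fun T => isTorsor_forgetMod T.obj T.property)).IsEquivalence where
  faithful := ⟨fun {T T' f g} h => by
    refine ObjectProperty.hom_ext _ (Mod.hom_ext _ _ (hom_ext ?_))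
    exact congrArg (fun z => z.hom.hom) h⟩
  full := ⟨fun {T T'} f => by
    let _ : ModObj ((gammaStar E).obj K) T.obj.X.obj.X := ((forgetMod K).obj T.obj).mod
    let _ : ModObj ((gammaStar E).obj K) T'.obj.X.obj.X := ((forgetMod K).obj T'.obj).mod
    have : IsModHom ((gammaStar E).obj K) (M := T.obj.X.obj.X) (N := T'.obj.X.obj.X) f.hom.hom :=
      f.hom.isModHom
    let F : T.obj.X ⟶ T'.obj.X :=
      ⟨f.hom.hom, isLiftable_of_equivariant T.obj.X T'.obj.X (isTorsor_forgetMod _ T.property)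
        (isTorsor_forgetMod _ T'.property)
        (ModObj.smul (M := const E K) (X := T.obj.X)) rfl
        (ModObj.smul (M := const E K) (X := T'.obj.X)) rfl f.hom.hom⟩
    have : IsModHom (const E K) F := ⟨by
      refine hom_ext ?_
      refine (IsModHom.smul_hom (A := (gammaStar E).obj K) (f := f.hom.hom)).trans ?_
      exact (congrArg (· ≫ _) (whiskerLeft_f (const E K) F)).symm⟩
    exact ⟨ObjectProperty.homMk { hom := F }, rfl⟩⟩
  essSurj := ⟨fun T => by
    let _ := (ofTorsor T.obj T.property).modObj (ofTorsorSMul T.obj T.property) rfl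
    have h := (ofTorsor T.obj T.property).isTorsor_of_f rfl T.property
    exact ⟨⟨CategoryTheory.Mod.mk (A := const E K) (ofTorsor T.obj T.property), h⟩, ⟨Iso.refl _⟩⟩⟩

end CovProj

end

end ToposTorsors

theorem mainTheorem5 {E : Type w} [Category.{u} E] [IsGrothendieckTopos E]
    [CartesianMonoidalCategory E] (K : Type u) [Group K] :
    ((CovProj.forget E).Faithful ∧
      ∃ h : ∀ T : TorsorCat (CovProj.const E K),
          IsTorsor ((gammaStar E).obj K) ((CovProj.forgetMod K).obj T.obj).X,
        (CovProj.forgetTorsor h).IsEquivalence) ∧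
    (∀ (T : CategoryTheory.Mod E ((gammaStar E).obj K))
        (hT : IsTorsor ((gammaStar E).obj K) T.X),
      (selfSplit T hT).IsCoveringProjection ∧
      ∃ M : ModObj (LocConst.const (selfCover T hT) K) (selfSplit T hT),
        IsTorsor (LocConst.const (selfCover T hT) K) (selfSplit T hT) ∧
        LocConst.Hom.f M.smul = T.mod.smul ∧
        ∀ i, LocConst.Hom.ϑ M.smul i = fun p : K × K => p.1 * p.2) ∧
    (∀ (𝒰 : Cover E) (T : CategoryTheory.Mod (LocConst 𝒰) (LocConst.const 𝒰 K)),
      IsTorsor (LocConst.const 𝒰 K) T.X →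
      T.X.IsCoveringProjection ∧
      ∃ (hT : IsTorsor ((gammaStar E).obj K) ((LocConst.forgetMod K).obj T).X)
        (r : Refinement 𝒰 (selfCover ((LocConst.forgetMod K).obj T) hT))
        (M : ModObj (LocConst.const 𝒰 K)
          ((selfSplit ((LocConst.forgetMod K).obj T) hT).pull r))
        (e : CategoryTheory.Mod.mk (A := LocConst.const 𝒰 K)
          ((selfSplit ((LocConst.forgetMod K).obj T) hT).pull r) ≅ T),
        LocConst.Hom.f M.smul = LocConst.Hom.f T.mod.smul ∧
        (∀ i, LocConst.Hom.ϑ M.smul i = fun p : K × K => p.1 * p.2) ∧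
        LocConst.Hom.f e.hom.hom = 𝟙 T.X.X) :=
  ⟨⟨inferInstance, fun T => CovProj.isTorsor_forgetMod T.obj T.property,
      CovProj.forgetTorsor_isEquivalence⟩,
    fun T hT => ⟨isCoveringProjection_selfSplit T hT, exists_modObj_selfSplit T hT⟩,
    fun 𝒰 T h => locConst_torsor 𝒰 T h⟩
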